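/- Let $a>0$ and let $M_a^3=\{(x,y,z,w)\in\mathbb R^4 : x^2+y^2=a^2(1-z^2-w^2)\}$ carry the Riemannian metric induced by $\mathbb R^4$, with Levi-Civita connection $\nabla$; all functions and vector fields on $M_a^3$ are smooth. Use the coordinates $(\xi,\mu,\chi)$ given by $(x,y,z,w)=(a\cos\xi\sin\chi,\ a\sin\xi\sin\chi,\ \cos\mu\cos\chi,\ \sin\mu\cos\chi)$; thus $\partial_\xi=(-y,x,0,0)$, $\partial_\mu=(0,0,-w,z)$ and $\chi=\arccos\sqrt{z^2+w^2}\in[0,\pi/2]$ on all of $M_a^3$. A vector field $Z$ is a zonal flow if (1) $Z=fX$ for a function $f$ and a Killing vector field $X$, (2) $\operatorname{div}Z=0$, and (3) the $L^2$-projection of $\nabla_ZZ$ to the divergence-free fields vanishes, i.e. $\nabla_ZZ=-\operatorname{grad}p$ for some function $p$. A zonal flow $Z$ is geodesic if $\nabla_ZZ=0$, and non-geodesic otherwise. It is an $S^1$-zonal flow if it can be written as $Z=fX$ with a function $f$ and a Killing vector field $X$ that is induced by a smooth $S^1$-action on $M_a^3$. For $p,q\in\mathbb R$ put $q/p=\infty$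 if $p=0$. 1. Let $a\neq1$ and let $Z$ be a non-geodesic zonal flow on $M_a^3$. Then there are $p,q\in\mathbb R$ with $a^2p^2\ne q^2$ and a function $f=f(\chi)$ on $M_a^3$ that depends only on $\chi$ such that $Z=f\,(p\,\partial_\xi+q\,\partial_\mu)$. 2. Let $Z=f\,(p\,\partial_\xi+q\,\partial_\mu)$ be a zonal flow on $M_a^3$ that is not identically zero, with $p,q\in\mathbb R$ and a function $f$. Then $Z$ is an $S^1$-zonal flow if and only if $q/p\in\mathbb Q\cup\{\infty\}$. 3. Let $a\neq1$ and let $Z$ be a zonal flow on $M_a^3$. Then $Z$ is a non-geodesic $S^1$-zonal flow if and only if there are $p,q\in\mathbb R$ with $a^2p^2\ne q^2$ and $q/p\in\mathbb Q\cup\{\infty\}$ and a function $f=f(\chi)$ on $M_a^3$ that depends only on $\chi$ and is not identically zero such that $Z=f\,(p\,\partial_\xi+q\,\partial_\mu)$. -/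

import Mathlib

open scoped ContDiff

namespace ZonalFlow

noncomputable section

/-! ### Riemannian geometry of a submanifold of a Euclidean space

A Riemannian manifold is given as a closed embedded submanifold `M` of a finite-dimensional
Euclidean space `E`, with the metric induced by `E`. Its smooth functions are the restrictions of
the smooth functions on `E`. -/

/-- A map on `M` is smooth if it is the restriction of a smooth map on the ambient space. -/
def IsSmooth {E F : Type*} [NormedAddCommGroup E] [NormedSpace ℝ E]
    [NormedAddCommGroup F] [NormedSpace ℝ F] (M : Set E) (f : M → F) : Prop :=
  ∃ g : E → F, ContDiff ℝ ∞ g ∧ ∀ x : M, g x = f x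

/-- The tangent space `T_x M`, as a subspace of `E`: the common kernel of the differentials at `x`
of the smooth functions that vanish on `M`. -/
def tangentSpace {E : Type*} [NormedAddCommGroup E] [NormedSpace ℝ E] (M : Set E) (x : E) :
    Submodule ℝ E where
  carrier := {v | ∀ g : E → ℝ, ContDiff ℝ ∞ g → (∀ y ∈ M, g y = 0) → fderiv ℝ g x v = 0}
  add_mem' := by
    intro v w hv hw g hg h0
    rw [map_add, hv g hg h0, hw g hg h0, add_zero]
  zero_mem' := by
    intro g _ _
    exact map_zero _
  smul_mem' := by
    intro c v hv g hg h0
    rw [map_smul, hv g hg h0, smul_zero]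

open Classical in
/-- A smooth extension of `f` to the ambient space (zero if `f` is not smooth). -/
def extension {E F : Type*} [NormedAddCommGroup E] [NormedSpace ℝ E]
    [NormedAddCommGroup F] [NormedSpace ℝ F] (M : Set E) (f : M → F) : E → F :=
  if h : IsSmooth M f then h.choose else 0

/-- The differential at `x` of a smooth map on `M`, as a linear map on `T_x M`. -/
def differential {E F : Type*} [NormedAddCommGroup E] [NormedSpace ℝ E]
    [NormedAddCommGroup F] [NormedSpace ℝ F] (M : Set E) (f : M → F) (x : M) :
    tangentSpace M (x : E) →ₗ[ℝ] F :=
  (fderiv ℝ (extension M f) (x : E)).toLinearMap ∘ₗ (tangentSpace M (x : E)).subtype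

/-- The differential does not depend on the extension that is used to compute it. -/
theorem differential_apply {E F : Type*} [NormedAddCommGroup E] [NormedSpace ℝ E]
    [NormedAddCommGroup F] [NormedSpace ℝ F] (M : Set E) (f : M → F) (g : E → F)
    (hg : ContDiff ℝ ∞ g) (hgf : ∀ x : M, g x = f x) (x : M) (v : tangentSpace M (x : E)) :
    differential M f x v = fderiv ℝ g (x : E) (v : E) := by
  have hs : IsSmooth M f := ⟨g, hg, hgf⟩
  have he : extension M f = hs.choose := by simp [extension, hs]
  obtain ⟨h1, h2⟩ := hs.choose_spec
  rw [← he] at h1 h2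
  change fderiv ℝ (extension M f) (x : E) (v : E) = _
  rw [← sub_eq_zero]
  apply SeparatingDual.eq_zero_of_forall_dual_eq_zero (R := ℝ)
  intro l
  have hd : DifferentiableAt ℝ (extension M f) (x : E) :=
    (h1.differentiable (by simp)).differentiableAt
  have hd' : DifferentiableAt ℝ g (x : E) := (hg.differentiable (by simp)).differentiableAt
  have key := v.2 (fun y => l (extension M f y - g y)) (l.contDiff.comp (h1.sub hg))
    (fun y hy => by simp [h2 ⟨y, hy⟩, hgf ⟨y, hy⟩])
  have hf : HasFDerivAt (fun y => l (extension M f y - g y))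
      (l.comp (fderiv ℝ (extension M f) (x : E) - fderiv ℝ g (x : E))) (x : E) :=
    l.hasFDerivAt.comp (x : E) (hd.hasFDerivAt.sub hd'.hasFDerivAt)
  rw [hf.fderiv] at key
  simpa using key

/-- Smooth vector fields on `M`. -/
structure VectorField {E : Type*} [NormedAddCommGroup E] [NormedSpace ℝ E] (M : Set E) where
  /-- the value at a point, a tangent vector -/
  val : ∀ x : M, tangentSpace M (x : E)
  /-- smoothness -/
  smooth : IsSmooth M (fun x => (val x : E))

section Metric

variable {E : Type*} [NormedAddCommGroup E] [InnerProductSpace ℝ E] [FiniteDimensional ℝ E]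
  {M : Set E}

/-- The Levi-Civita connection of the induced metric, `v ↦ ∇_v Y` on `T_x M`: the tangential part
of the Euclidean directional derivative. -/
def nabla (Y : VectorField M) (x : M) : tangentSpace M (x : E) →ₗ[ℝ] tangentSpace M (x : E) :=
  (tangentSpace M (x : E)).orthogonalProjectionOnto.toLinearMap ∘ₗ
    differential M (fun y => (Y.val y : E)) x

/-- The gradient of a function on `M`: the tangent vector that represents the differential. -/
def grad (f : M → ℝ) (x : M) : tangentSpace M (x : E) :=
  (InnerProductSpace.toDual ℝ (tangentSpace M (x : E))).symm
    (LinearMap.toContinuousLinearMap (differential M f x))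

/-- The divergence of a vector field, the trace of `v ↦ ∇_v Y`. -/
def divergence (Y : VectorField M) (x : M) : ℝ :=
  LinearMap.trace ℝ (tangentSpace M (x : E)) (nabla Y x)

/-- Killing vector fields: `g (∇_V X, W) = - g (∇_W X, V)`. -/
def IsKilling (X : VectorField M) : Prop :=
  ∀ (x : M) (v w : tangentSpace M (x : E)),
    inner ℝ (nabla X x v) w = -inner ℝ (nabla X x w) v

/-- `Z` is a zonal flow: `Z = f X` with `f` a function and `X` Killing, `div Z = 0`, and
`P (∇_Z Z) = 0`, where `P` is the projection to the divergence-free fields along the gradient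
fields, so that the last condition says `∇_Z Z = - grad p` for a function `p`. -/
def IsZonal (Z : VectorField M) : Prop :=
  (∃ (f : M → ℝ) (X : VectorField M), IsSmooth M f ∧ IsKilling X ∧
    ∀ x, Z.val x = f x • X.val x) ∧
  (∀ x, divergence Z x = 0) ∧
  ∃ p : M → ℝ, IsSmooth M p ∧ ∀ x, nabla Z x (Z.val x) = -grad p x

/-- A geodesic zonal flow is a zonal flow `Z` with `∇_Z Z = 0`. -/
def IsGeodesicZonal (Z : VectorField M) : Prop :=
  IsZonal Z ∧ ∀ x, nabla Z x (Z.val x) = 0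

/-- A non-geodesic zonal flow. -/
def IsNonGeodesicZonal (Z : VectorField M) : Prop :=
  IsZonal Z ∧ ¬ IsGeodesicZonal Z

/-- `X` is induced by a smooth action of the circle group on `M`: `X x` is the velocity at time
zero of the curve `t ↦ exp (i t) • x`. Smoothness of the action means that it is the restriction
to `Circle × M` of a smooth map on `ℂ × E`. -/
def IsInducedByCircleAction (X : VectorField M) : Prop :=
  ∃ act : MulAction Circle M,
    (∃ Φ : ℂ × E → E, ContDiff ℝ ∞ Φ ∧
      ∀ (θ : Circle) (x : M), Φ ((θ : ℂ), (x : E)) = ((act.smul θ x : M) : E)) ∧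
    ∀ x : M, HasDerivAt (fun t : ℝ => ((act.smul (Circle.exp t) x : M) : E)) (X.val x : E) 0

/-- An `S¹`-zonal flow is a zonal flow `Z = f X` whose Killing field `X` is induced by an
`S¹`-action. -/
def IsCircleZonal (Z : VectorField M) : Prop :=
  IsZonal Z ∧ ∃ (f : M → ℝ) (X : VectorField M), IsSmooth M f ∧ IsKilling X ∧
    (∀ x, Z.val x = f x • X.val x) ∧ IsInducedByCircleAction X

end Metric

/-! ### The three-dimensional ellipsoid -/

/-- `M_a³ = {(x, y, z, w) | x² + y² = a² (1 - z² - w²)}`. -/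
def ellipsoid (a : ℝ) : Set (EuclideanSpace ℝ (Fin 4)) :=
  {u | u 0 ^ 2 + u 1 ^ 2 = a ^ 2 * (1 - u 2 ^ 2 - u 3 ^ 2)}

/-- The tangent spaces of the ellipsoid. -/
theorem mem_tangentSpace_ellipsoid (a : ℝ) (ha : 0 < a) (x : EuclideanSpace ℝ (Fin 4)) (hx : x ∈ ellipsoid a)
    (v : EuclideanSpace ℝ (Fin 4)) :
    v ∈ tangentSpace (ellipsoid a) x ↔ x 0 * v 0 + x 1 * v 1 + a^2*(x 2 * v 2 + x 3 * v 3) = 0 := by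
  have hx' : x 0 ^ 2 + x 1 ^ 2 = a ^ 2 * (1 - x 2 ^ 2 - x 3 ^ 2) := hx
  constructor
  · intro h
    have := h (fun u => u 0 ^ 2 + u 1 ^ 2 - a ^ 2 * (1 - u 2 ^ 2 - u 3 ^ 2))
      (by fun_prop) (fun y hy => sub_eq_zero.2 hy)
    have hd : ∀ i : Fin 4, HasFDerivAt (fun u : EuclideanSpace ℝ (Fin 4) => u i)
      (EuclideanSpace.proj i : EuclideanSpace ℝ (Fin 4) →L[ℝ] ℝ) x := fun i =>
       (EuclideanSpace.proj i : EuclideanSpace ℝ (Fin 4) →L[ℝ] ℝ).hasFDerivAt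
    have hF := (((hd 0).pow 2).add ((hd 1).pow 2)).sub
      (((((hd 2).pow 2).const_sub 1).sub ((hd 3).pow 2)).const_mul (a^2))
    rw [show (fun u : EuclideanSpace ℝ (Fin 4) => u 0 ^ 2 + u 1 ^ 2 - a ^ 2 * (1 - u 2 ^ 2 - u 3 ^ 2)) = _ from rfl] at this
    erw [hF.fderiv] at this
    simp at this
    linarith
  · intro h g hg h0
    set Q : ℝ := (v 0 ^2 + v 1 ^2)/a^2 + v 2 ^2 + v 3^2 with hQ
    have hQ0 : 0 ≤ Q := by positivity
    have key : ∀ t : ℝ, g ((Real.sqrt (1 + t^2*Q))⁻¹ • (x + t • v)) = 0 := by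
      intro t
      apply h0
      have hp : 0 < 1 + t^2*Q := by positivity
      have hs := Real.sq_sqrt hp.le
      have hs0 := Real.sqrt_pos.2 hp
      set s := Real.sqrt (1 + t^2*Q)
      change (s⁻¹ * (x 0 + t * v 0))^2 + (s⁻¹ * (x 1 + t * v 1))^2 =
        a^2*(1 - (s⁻¹ * (x 2 + t * v 2))^2 - (s⁻¹ * (x 3 + t * v 3))^2)
      field_simp
      rw [hs, hQ]
      field_simp
      linear_combination hx' + 2*t*h
    have hd1 : HasDerivAt (fun t : ℝ => (Real.sqrt (1 + t^2*Q))⁻¹) 0 0 := by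
      have h1 : HasDerivAt (fun t : ℝ => 1 + t^2*Q) 0 0 := by
        have := (((hasDerivAt_id (0:ℝ)).pow 2).mul_const Q).const_add 1
        simpa using this
      have := (h1.sqrt (by simp)).inv (by simp)
      have h3 : HasDerivAt (fun t : ℝ => Real.sqrt (1 + t^2*Q))⁻¹ 0 0 := by simpa using this
      exact h3
    have hd2 : HasDerivAt (fun t : ℝ => x + t • v) v 0 := by
      simpa using ((hasDerivAt_id (0:ℝ)).smul_const v).const_add x
    have hd := hd1.smul hd2
    have hgd : HasFDerivAt g (fderiv ℝ g x) ((fun t : ℝ => (Real.sqrt (1 + t^2*Q))⁻¹ • (x + t • v)) 0) := by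
      simpa using ((hg.differentiable (by simp)).differentiableAt (x := x)).hasFDerivAt
    have hc := hgd.comp_hasDerivAt (0:ℝ) hd
    have hz : HasDerivAt (g ∘ (fun t : ℝ => (Real.sqrt (1 + t^2*Q))⁻¹ • (x + t • v))) 0 0 := by
      rw [show (g ∘ (fun t : ℝ => (Real.sqrt (1 + t^2*Q))⁻¹ • (x + t • v))) = fun _ => 0 from funext key]
      exact hasDerivAt_const _ _
    simpa using hc.unique hz

/-- The Hopf coordinates `(ξ, μ, χ)`. -/
def hopf (a ξ μ χ : ℝ) : EuclideanSpace ℝ (Fin 4) :=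
  !₂[a * Real.cos ξ * Real.sin χ, a * Real.sin ξ * Real.sin χ,
    Real.cos μ * Real.cos χ, Real.sin μ * Real.cos χ]

/-- `∂_ξ`, extended to the whole ellipsoid. -/
def dXi (u : EuclideanSpace ℝ (Fin 4)) : EuclideanSpace ℝ (Fin 4) := !₂[-u 1, u 0, 0, 0]

/-- `∂_μ`, extended to the whole ellipsoid. -/
def dMu (u : EuclideanSpace ℝ (Fin 4)) : EuclideanSpace ℝ (Fin 4) := !₂[0, 0, -u 3, u 2]

/-- The coordinate `χ ∈ [0, π/2]`, extended to the whole ellipsoid: `cos χ = √(z² + w²)`. -/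
def chi (u : EuclideanSpace ℝ (Fin 4)) : ℝ := Real.arccos (Real.sqrt (u 2 ^ 2 + u 3 ^ 2))

theorem hopf_mem (a ξ μ χ : ℝ) : hopf a ξ μ χ ∈ ellipsoid a := by
  change (hopf a ξ μ χ) 0 ^ 2 + (hopf a ξ μ χ) 1 ^ 2 =
    a ^ 2 * (1 - (hopf a ξ μ χ) 2 ^ 2 - (hopf a ξ μ χ) 3 ^ 2)
  simp [hopf]
  linear_combination (a ^ 2 * Real.sin χ ^ 2) * Real.sin_sq_add_cos_sq ξ
    + a ^ 2 * Real.cos χ ^ 2 * Real.sin_sq_add_cos_sq μ + a ^ 2 * Real.sin_sq_add_cos_sq χ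

theorem hasDerivAt_of_coord (c : ℝ → EuclideanSpace ℝ (Fin 4)) (v : EuclideanSpace ℝ (Fin 4))
    (t : ℝ) (h : ∀ i, HasDerivAt (fun s => c s i) (v i) t) : HasDerivAt c v t := by
  rw [hasDerivAt_iff_hasFDerivAt, ← hasFDerivWithinAt_univ, hasFDerivWithinAt_euclidean]
  intro i
  rw [hasFDerivWithinAt_univ]
  refine (h i).hasFDerivAt.congr_fderiv ?_
  ext
  simp

theorem hasDerivAt_hopf_xi (a ξ μ χ : ℝ) :
    HasDerivAt (fun t => hopf a t μ χ) (dXi (hopf a ξ μ χ)) ξ := by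
  apply hasDerivAt_of_coord
  have hc := ((Real.hasDerivAt_cos ξ).const_mul a).mul_const (Real.sin χ)
  have hs := ((Real.hasDerivAt_sin ξ).const_mul a).mul_const (Real.sin χ)
  intro i
  fin_cases i
  · simpa [hopf, dXi] using hc
  · simpa [hopf, dXi] using hs
  · simpa [hopf, dXi] using hasDerivAt_const ξ _
  · simpa [hopf, dXi] using hasDerivAt_const ξ _

theorem hasDerivAt_hopf_mu (a ξ μ χ : ℝ) :
    HasDerivAt (fun t => hopf a ξ t χ) (dMu (hopf a ξ μ χ)) μ := by
  apply hasDerivAt_of_coord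
  have hc := (Real.hasDerivAt_cos μ).mul_const (Real.cos χ)
  have hs := (Real.hasDerivAt_sin μ).mul_const (Real.cos χ)
  intro i
  fin_cases i
  · simpa [hopf, dMu] using hasDerivAt_const μ _
  · simpa [hopf, dMu] using hasDerivAt_const μ _
  · simpa [hopf, dMu] using hc
  · simpa [hopf, dMu] using hs

theorem chi_hopf (a ξ μ χ : ℝ) (h0 : 0 ≤ χ) (h1 : χ ≤ Real.pi / 2) :
    chi (hopf a ξ μ χ) = χ := by
  have hc : 0 ≤ Real.cos χ := Real.cos_nonneg_of_mem_Icc ⟨by linarith [Real.pi_pos], h1⟩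
  have e : (hopf a ξ μ χ) 2 ^ 2 + (hopf a ξ μ χ) 3 ^ 2 = Real.cos χ ^ 2 := by
    simp only [hopf]
    simp
    linear_combination Real.cos χ ^ 2 * Real.sin_sq_add_cos_sq μ
  rw [chi, e, Real.sqrt_sq hc, Real.arccos_cos h0 (by linarith [Real.pi_pos])]

/-- The convention `q / p = ∞` for `p = 0`, and `q / p ∈ ℚ ∪ {∞}`. -/
def RatioRationalOrInfinite (p q : ℝ) : Prop := p = 0 ∨ ∃ r : ℚ, q / p = r

end

end ZonalFlow

namespace ZonalFlow

noncomputable section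

/-! ### Commuting derivations -/

section Derivations

variable {A ι : Type*} [CommRing A] [Algebra ℝ A] {D : ι → Derivation ℝ A A}

/-! Killing fields of the ellipsoid are restrictions of skew linear maps, by infinitesimal rigidity.
Central projection turns an open hemisphere into the graph of `h = -√(1 + ∑ wᵢ yᵢ²)` over `ℝ³`.
Infinitesimal isometric deformations are projectively invariant
(`killing_equation_of_central_projection`), so the field becomes a pair `(T, S)` with `∂ⱼTᵢ + ∂ᵢTⱼ +
∂ᵢh ∂ⱼS + ∂ⱼh ∂ᵢS = 0`. Eliminating `T` makes the Kulkarni–Nomizu product of the Hessians of `h` and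
`S` vanish. In dimension three, with the Hessian of `h` nondegenerate, this forces `S` to be affine.
Then `T` is explicit and the deformation is an infinitesimal rigid motion
(`exists_affine_of_killing`). Tangency kills the translation, continuity at the equator glues the
hemispheres, and for `a ≠ 1` tangency leaves only `X = p ∂_ξ + q ∂_μ`.

For `Z = f X` one has `div Z = X f`, so a divergence-free `Z` satisfies `∇_Z Z = f² ∇_X X = -½ f²
grad |X|²`, where `|X|² = a² p² sin² χ + q² cos² χ`. If `a² p² = q²`, this is zero. Otherwise the
pressure is invariant under the torus of rotations, so its `χ`-derivative is too. Hence `f²`, and by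
connectedness `f`, is constant on each torus `χ = const` (`factor_eq_of_chi`).

A rotation field with integral weights generates a circle action. Conversely, a rotation field
induced by a circle action has `2π`-periodic orbits, hence integral weights. A Killing field
proportional to `X` on an open set is itself a rotation field with the same ratio (`minor_eq_zero`),
so rationality of `q / p` does not depend on the chosen factorisation of `Z`. -/

theorem eq_zero_of_two_mul_eq_zero {x : A} (h : 2 * x = 0) : x = 0 := by
  have : (2 : ℝ) • x = 0 := by
    rw [two_smul, ← two_mul, h]
  exact (smul_eq_zero_iff_right (two_ne_zero' ℝ)).1 this

/-- The Saint-Venant compatibility condition of a symmetrised product of gradients: the Hessians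
have vanishing Kulkarni–Nomizu product. -/
theorem kulkarniNomizu_eq_zero (hD : ∀ i j f, D i (D j f) = D j (D i f)) {T : ι → A} {h S : A}
    (hK : ∀ i j, D j (T i) + D i (T j) + D i h * D j S + D j h * D i S = 0) (i j k l : ι) :
    D i (D l h) * D j (D k S) + D j (D k h) * D i (D l S)
      - D k (D l h) * D i (D j S) - D i (D j h) * D k (D l S) = 0 := by
  have e1 := congrArg (D k) (congrArg (D l) (hK i j))
  have e2 := congrArg (D i) (congrArg (D j) (hK k l))
  have e3 := congrArg (D i) (congrArg (D l) (hK k j))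
  have e4 := congrArg (D k) (congrArg (D j) (hK i l))
  -- `hD` permutes, so `simp` sorts iterated derivations. In the alternating sum the terms in `T`
  -- and the third derivatives of `h` and `S` cancel; the rest appears twice.
  simp only [map_add, Derivation.leibniz, smul_eq_mul, map_zero, hD] at e1 e2 e3 e4 ⊢
  apply eq_zero_of_two_mul_eq_zero
  linear_combination e1 + e2 - e3 - e4

/-- The second derivatives of a flat Killing field vanish. -/
theorem second_derivation_eq_zero (hD : ∀ i j f, D i (D j f) = D j (D i f)) {R : ι → A}
    (hR : ∀ i j, D j (R i) + D i (R j) = 0) (i j k : ι) : D k (D j (R i)) = 0 := by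
  have e1 := congrArg (D k) (hR i j)
  have e2 := congrArg (D i) (hR j k)
  have e3 := congrArg (D j) (hR i k)
  simp only [map_add, map_zero, hD] at e1 e2 e3 ⊢
  apply eq_zero_of_two_mul_eq_zero
  -- The cyclic permutation trick that also proves the Koszul formula.
  linear_combination e1 - e2 + e3

end Derivations

/-! ### The algebra of smooth functions on `ℝⁿ` -/

/-- The smooth functions on `ℝⁿ`. -/
def smoothFunctions (n : ℕ) : Subalgebra ℝ ((Fin n → ℝ) → ℝ) where
  carrier := {f | ContDiff ℝ ∞ f}
  mul_mem' := by
    intro f g hf hg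
    exact ContDiff.mul (𝕜 := ℝ) (n := ∞) hf hg
  add_mem' := by
    intro f g hf hg
    exact ContDiff.add (𝕜 := ℝ) (n := ∞) hf hg
  algebraMap_mem' := fun c => (contDiff_const : ContDiff ℝ ∞ fun _ : Fin n → ℝ => c)

theorem contDiff_coe {n : ℕ} (f : smoothFunctions n) :
    ContDiff ℝ ∞ f.1 := f.2

theorem differentiable_coe {n : ℕ} (f : smoothFunctions n) :
    Differentiable ℝ f.1 := (contDiff_coe f).differentiable (by simp)

/-- The partial derivatives of smooth functions. -/
def partialDeriv {n : ℕ} (i : Fin n) :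
    Derivation ℝ (smoothFunctions n) (smoothFunctions n) :=
  Derivation.mk'
    { toFun := fun f => ⟨fun x => fderiv ℝ f.1 x (Pi.single i 1),
        ((contDiff_coe f).fderiv_right (m := ∞) (by simp)).clm_apply contDiff_const⟩
      map_add' := fun f g => by
        ext x
        have := fderiv_add ((differentiable_coe f) x) ((differentiable_coe g) x)
        simp [this]
      map_smul' := fun c f => by
        ext x
        have := fderiv_const_smul ((differentiable_coe f) x) c
        simp [this] }
    (fun f g => by
      ext x
      have := fderiv_mul ((differentiable_coe f) x) ((differentiable_coe g) x)
      simp [this])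

theorem partialDeriv_apply {n : ℕ} (i : Fin n) (f : smoothFunctions n) (x : Fin n → ℝ) :
    (partialDeriv i f).1 x = fderiv ℝ f.1 x (Pi.single i 1) := rfl

theorem partialDeriv_comm {n : ℕ} (i j : Fin n) (f : smoothFunctions n) :
    partialDeriv i (partialDeriv j f) = partialDeriv j (partialDeriv i f) := by
  have key : ∀ (i j : Fin n) (x : Fin n → ℝ),
      (partialDeriv i (partialDeriv j f)).1 x =
        fderiv ℝ (fderiv ℝ f.1) x (Pi.single i 1) (Pi.single j 1) := by
    intro i j x
    rw [partialDeriv_apply]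
    have hd : DifferentiableAt ℝ (fderiv ℝ f.1) x :=
      (((contDiff_coe f).fderiv_right (m := ∞) (by simp)).differentiable (by simp)) x
    change fderiv ℝ (fun y => fderiv ℝ f.1 y (Pi.single j 1)) x _ = _
    rw [fderiv_clm_apply hd (differentiableAt_const _)]
    simp
  ext x
  rw [key, key]
  exact ((contDiff_coe f).contDiffAt.isSymmSndFDerivAt
    (by simpa using (WithTop.coe_le_coe.2 le_top : ((2 : ℕ∞) : WithTop ℕ∞) ≤ ∞))) _ _

theorem eq_of_partialDeriv_eq_zero {n : ℕ} (f : smoothFunctions n)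
    (hf : ∀ i, partialDeriv i f = 0) (x : Fin n → ℝ) :
    f.1 x = f.1 0 := by
  refine is_const_of_fderiv_eq_zero (differentiable_coe f) (fun y => ?_) x 0
  apply ContinuousLinearMap.coe_injective
  refine LinearMap.pi_ext' fun i => LinearMap.ext_ring ?_
  have := congrFun (congrArg Subtype.val (hf i)) y
  simpa [partialDeriv_apply] using this

/-- The coordinate functions. -/
def coordinate {n : ℕ} (i : Fin n) : smoothFunctions n :=
  ⟨fun x => x i, (contDiff_apply ℝ ℝ i : ContDiff ℝ ∞ fun x : Fin n → ℝ => x i)⟩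

theorem coordinate_apply {n : ℕ} (i : Fin n) (x : Fin n → ℝ) :
    (coordinate i).1 x = x i := rfl

theorem partialDeriv_coordinate {n : ℕ} (i j : Fin n) :
    partialDeriv i (coordinate j) = if i = j then 1 else 0 := by
  ext x
  rw [partialDeriv_apply]
  have : fderiv ℝ (coordinate j).1 x = ContinuousLinearMap.proj j :=
    (ContinuousLinearMap.proj (R := ℝ) (φ := fun _ : Fin n => ℝ) j).fderiv
  rw [this]
  by_cases h : i = j
  · subst h; simp
  · simp [h, Ne.symm h]

theorem eq_affine {n : ℕ} (f : smoothFunctions n)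
    (hf : ∀ i j, partialDeriv i (partialDeriv j f) = 0) (x : Fin n → ℝ) :
    f.1 x = f.1 0 +
      ∑ j, (partialDeriv j f).1 0 * x j := by
  set c : Fin n → ℝ := fun j => (partialDeriv j f).1 0 with hc
  have hconst : ∀ j, partialDeriv j f = algebraMap ℝ _ (c j) := by
    intro j
    ext y
    exact eq_of_partialDeriv_eq_zero (partialDeriv j f) (fun i => hf i j) y
  have h := eq_of_partialDeriv_eq_zero (f - ∑ j, c j • coordinate j) (fun i => by
    simp only [map_sub, map_sum, Derivation.map_smul, partialDeriv_coordinate, hconst]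
    simp [Algebra.algebraMap_eq_smul_one]) x
  simp [coordinate_apply] at h
  linarith

/-! ### Symmetric matrices with vanishing Kulkarni–Nomizu product -/

/-- In dimension three a symmetric form whose Kulkarni–Nomizu product with a nondegenerate one is
zero vanishes. -/
theorem eq_zero_of_kulkarniNomizu_eq_zero {H S : Matrix (Fin 3) (Fin 3) ℝ}
    (hS : S.IsSymm) (hdet : H.det ≠ 0)
    (h : ∀ i j k l, H i l * S j k + H j k * S i l - H k l * S i j - H i j * S k l = 0) :
    S = 0 := by
  -- Contraction with the adjugate of `H` gives `(3 - 2) det H • S + tr(adj H * S) • H = 0`; the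
  -- coefficient `n - 2` is where the dimension matters.
  have key : ∀ j k, H.det * S j k + H j k * (H.adjugate * S).trace = 0 := by
    intro j k
    have e1 : ∑ i, ∑ l, H.adjugate l i *
        (H i l * S j k + H j k * S i l - H k l * S i j - H i j * S k l) = 0 := by
      simp [h]
    have e2 : ∑ i, ∑ l, H.adjugate l i *
        (H i l * S j k + H j k * S i l - H k l * S i j - H i j * S k l) =
        (H.adjugate * H).trace * S j k + H j k * (H.adjugate * S).trace
          - (H * H.adjugate * S) k j - (S * (H.adjugate * H)) k j := by
      simp only [Matrix.trace, Matrix.diag, Matrix.mul_apply, Fin.sum_univ_three]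
      ring
    rw [e2, Matrix.adjugate_mul, Matrix.mul_adjugate, Matrix.trace_smul, Matrix.trace_one,
      Matrix.smul_mul, Matrix.mul_smul, Matrix.one_mul, Matrix.mul_one, Matrix.smul_apply] at e1
    have := hS.apply j k
    simp only [Fintype.card_fin, smul_eq_mul] at e1
    rw [this] at e1
    push_cast at e1
    linarith
  -- A second contraction yields `(1 + 3) det H * tr(adj H * S) = 0`.
  have ht : (H.adjugate * S).trace = 0 := by
    have e1 : ∑ j, ∑ k, H.adjugate k j *
        (H.det * S j k + H j k * (H.adjugate * S).trace) = 0 := by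
      simp [key]
    have e2 : ∑ j, ∑ k, H.adjugate k j *
        (H.det * S j k + H j k * (H.adjugate * S).trace) =
        H.det * (H.adjugate * S).trace + (H.adjugate * H).trace * (H.adjugate * S).trace := by
      simp only [Matrix.trace, Matrix.diag, Matrix.mul_apply, Fin.sum_univ_three]
      ring
    rw [e2, Matrix.adjugate_mul, Matrix.trace_smul, Matrix.trace_one] at e1
    simp only [Fintype.card_fin, smul_eq_mul] at e1
    push_cast at e1
    have : H.det * (H.adjugate * S).trace = 0 := by linarith
    exact (mul_eq_zero.1 this).resolve_left hdet
  ext j k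
  have := key j k
  rw [ht] at this
  simpa [hdet] using this

/-- Rigidity: the solutions of a Killing type equation on `ℝ³` with nondegenerate Hessian. -/
theorem exists_affine_of_killing {T : Fin 3 → smoothFunctions 3} {h S : smoothFunctions 3}
    (hK : ∀ i j, partialDeriv j (T i) + partialDeriv i (T j) + partialDeriv i h * partialDeriv j S
      + partialDeriv j h * partialDeriv i S = 0)
    (hdet : ∀ x, (Matrix.of fun i j : Fin 3 =>
      (partialDeriv i (partialDeriv j h)).1 x).det ≠ 0) :
    ∃ (c b : Fin 3 → ℝ) (s : ℝ) (L : Matrix (Fin 3) (Fin 3) ℝ), (∀ i j, L i j = -L j i) ∧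
      (∀ x, S.1 x = s + ∑ j, c j * x j) ∧
      ∀ i x, (T i).1 x =
        -c i * h.1 x + b i + ∑ j, L i j * x j := by
  have hKN : ∀ x i j k l,
      (partialDeriv i (partialDeriv l h)).1 x * (partialDeriv j (partialDeriv k S)).1 x
      + (partialDeriv j (partialDeriv k h)).1 x * (partialDeriv i (partialDeriv l S)).1 x
      - (partialDeriv k (partialDeriv l h)).1 x * (partialDeriv i (partialDeriv j S)).1 x
      - (partialDeriv i (partialDeriv j h)).1 x * (partialDeriv k (partialDeriv l S)).1 x = 0 :=
    fun x i j k l => congrFun (congrArg Subtype.val (kulkarniNomizu_eq_zero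
      (A := smoothFunctions 3) (D := partialDeriv) partialDeriv_comm hK i j k l)) x
  have hS : ∀ i j, partialDeriv i (partialDeriv j S) = 0 := by
    intro i j
    ext x
    have := eq_zero_of_kulkarniNomizu_eq_zero
      (S := Matrix.of fun i j : Fin 3 =>
        (partialDeriv i (partialDeriv j S)).1 x)
      (by ext i j; simp only [Matrix.transpose_apply, Matrix.of_apply]; rw [partialDeriv_comm])
      (hdet x) (hKN x)
    exact congrFun (congrFun this i) j
  set c : Fin 3 → ℝ := fun j => (partialDeriv j S).1 0 with hc
  have hconst : ∀ j, partialDeriv j S = algebraMap ℝ _ (c j) := by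
    intro j
    ext y
    exact eq_of_partialDeriv_eq_zero (partialDeriv j S) (fun i => hS i j) y
  -- Since the gradient of `S` is the constant `c`, the mixed terms are absorbed by adding `c h` to
  -- `T`, which leaves a flat Killing field.
  have hR : ∀ i j, partialDeriv j (T i + c i • h) + partialDeriv i (T j + c j • h) = 0 := by
    intro i j
    have := hK i j
    simp only [hconst] at this
    simp only [map_add, Derivation.map_smul]
    simp only [Algebra.smul_def]
    linear_combination this
  have hR2 := second_derivation_eq_zero (A := smoothFunctions 3) (D := partialDeriv)
    (R := fun i => T i + c i • h) partialDeriv_comm hR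
  refine ⟨c, fun i => ((T i + c i • h : smoothFunctions 3)).1 0,
    S.1 0,
    Matrix.of fun i j => (partialDeriv j (T i + c i • h)).1 0, ?_,
    eq_affine S hS, ?_⟩
  · intro i j
    have := congrFun (congrArg Subtype.val (hR i j)) 0
    exact eq_neg_of_add_eq_zero_left this
  · intro i x
    have := eq_affine (T i + c i • h) (fun k j => hR2 i j k) x
    have e : ((T i + c i • h : smoothFunctions 3)).1 x =
      (T i).1 x + c i * h.1 x := rfl
    rw [e] at this
    simp only [Matrix.of_apply]
    linarith

/-! ### The connection in terms of an ambient extension -/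

section Connection

variable {E : Type*} [NormedAddCommGroup E] [InnerProductSpace ℝ E]
  {M : Set E}

theorem fderiv_mem_tangentSpace {F : Type*} [NormedAddCommGroup F] [NormedSpace ℝ F]
    {c : F → E} {y : F} (hc : DifferentiableAt ℝ c y) (hcM : ∀ z, c z ∈ M) (v : F) :
    fderiv ℝ c y v ∈ tangentSpace M (c y) := by
  intro g hg h0
  have h := (((hg.differentiable (by simp)) (c y)).hasFDerivAt.comp y hc.hasFDerivAt).fderiv
  have hz : g ∘ c = fun _ => 0 := funext fun z => h0 _ (hcM z)
  rw [hz, fderiv_fun_const] at h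
  exact (congrArg (fun l => l v) h).symm

theorem hasDerivAt_mem_tangentSpace {c : ℝ → E} {t : ℝ} {v : E} (hc : HasDerivAt c v t)
    (hcM : ∀ s, c s ∈ M) : v ∈ tangentSpace M (c t) := by
  have := fderiv_mem_tangentSpace hc.differentiableAt hcM 1
  rwa [fderiv_apply_one_eq_deriv, hc.deriv] at this

variable [FiniteDimensional ℝ E]

/-- Pairing with a tangent vector makes the orthogonal projection invisible, and any smooth
extension may be used. Thus covariant derivatives become ambient ones. -/
theorem inner_nabla (Y : VectorField M) {g : E → E} (hg : ContDiff ℝ ∞ g)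
    (hgY : ∀ x : M, g x = Y.val x) (x : M) (v w : tangentSpace M (x : E)) :
    inner ℝ (nabla Y x v) w = inner ℝ (fderiv ℝ g x v) (w : E) := by
  change inner ℝ ((tangentSpace M (x : E)).orthogonalProjectionOnto
    (differential M (fun y => (Y.val y : E)) x v)) w = _
  rw [differential_apply M (fun y => (Y.val y : E)) g hg hgY x v]
  exact Submodule.inner_orthogonalProjectionOnto_eq_of_mem_right _ _

theorem inner_grad (P : M → ℝ) {g : E → ℝ} (hg : ContDiff ℝ ∞ g)
    (hgP : ∀ x : M, g x = P x) (x : M) (v : tangentSpace M (x : E)) :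
    inner ℝ (grad P x) v = fderiv ℝ g x (v : E) := by
  rw [← differential_apply M P g hg hgP x v, grad, InnerProductSpace.toDual_symm_apply]
  rfl

/-- The divergence of `f X` with `X` Killing is the derivative of `f` along `X`. -/
theorem divergence_smul_killing {Z X : VectorField M} (hX : IsKilling X) {f : E → ℝ}
    (hf : ContDiff ℝ ∞ f) (hZ : ∀ x : M, Z.val x = f x • X.val x) (x : M) :
    divergence Z x = fderiv ℝ f x (X.val x : E) := by
  obtain ⟨g, hg, hgX⟩ := X.smooth
  have hfg : ContDiff ℝ ∞ fun y => f y • g y := hf.smul hg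
  have hd : ∀ v, fderiv ℝ (fun y => f y • g y) (x : E) v =
      f x • fderiv ℝ g x v + fderiv ℝ f x v • g x := by
    intro v
    rw [fderiv_fun_smul (hf.differentiable (by simp) _) (hg.differentiable (by simp) _)]
    simp
  let b := stdOrthonormalBasis ℝ (tangentSpace M (x : E))
  rw [divergence, LinearMap.trace_eq_sum_inner _ b]
  -- Skewness of `∇X` removes the diagonal terms; what remains sums to the derivative of `f` along
  -- the orthonormal expansion of `X`.
  have hb : ∀ i, inner ℝ (b i) (nabla Z x (b i)) =
      fderiv ℝ f x ((inner ℝ (b i) (X.val x) • b i : tangentSpace M (x : E)) : E) := by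
    intro i
    have hk := hX x (b i) (b i)
    rw [inner_nabla X hg hgX] at hk
    rw [real_inner_comm, inner_nabla Z hfg (fun y => by rw [hgX, hZ]; rfl), hd, inner_add_left,
      inner_smul_left, inner_smul_left, hgX]
    have h0 : inner ℝ (fderiv ℝ g x (b i : E)) (b i : E) = 0 := by linarith
    simp [h0, mul_comm, real_inner_comm]
  simp_rw [hb]
  rw [← map_sum, ← Submodule.coe_sum, b.sum_repr']

end Connection

/-! ### Killing fields of the ellipsoid, in a central projection chart -/

/-- The Darboux–Sauer correspondence: the point `ρ (y, ε)` goes to `(y, h)` with `h = -1/ρ`, and the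
deformation `(V, U)` to `(V / ρ, y · V + ε U)`. From `ρ h = -1` comes `h² ∂ρ = ∂h`, so `h²` times
the equation of the surface is the equation of the graph. -/
theorem killing_equation_of_central_projection {A : Type*} [CommRing A] [Algebra ℝ A]
    {D : Fin 3 → Derivation ℝ A A} {Y V : Fin 3 → A} {U ρ h : A} (ε : ℝ)
    (hY : ∀ i j, D i (Y j) = if i = j then 1 else 0) (hρ : ρ * h = -1)
    (hV : ∀ i j, (∑ k, D i (V k) * D j (ρ * Y k) + D i U * D j (ε • ρ)) +
      (∑ k, D j (V k) * D i (ρ * Y k) + D j U * D i (ε • ρ)) = 0) (i j : Fin 3) :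
    D j (-(h * V i)) + D i (-(h * V j)) + D i h * D j (∑ k, Y k * V k + ε • U)
      + D j h * D i (∑ k, Y k * V k + ε • U) = 0 := by
  have hDρ : ∀ i, D i ρ * h + ρ * D i h = 0 := by
    intro i
    have := congrArg (D i) hρ
    simp only [Derivation.leibniz, smul_eq_mul, map_neg, Derivation.map_one_eq_zero] at this
    linear_combination this
  have h1 : ∀ i, h ^ 2 * D i ρ = D i h := fun i => by
    linear_combination h * hDρ i - D i h * hρ
  have key := hV i j
  simp only [map_add, map_neg, Derivation.leibniz, hY, smul_eq_mul, Fin.sum_univ_three,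
    Algebra.smul_def, Derivation.map_algebraMap, mul_zero, add_zero] at key ⊢
  have hs : ∀ (i : Fin 3) (W : Fin 3 → A), (if i = 0 then 1 else 0) * W 0 +
      (if i = 1 then 1 else 0) * W 1 + (if i = 2 then 1 else 0) * W 2 = W i := by
    intro i W
    fin_cases i <;> simp
  have s1 := hs j (fun k => D i (V k))
  have s2 := hs i (fun k => D j (V k))
  have s3 := hs i V
  have s4 := hs j V
  linear_combination h ^ 2 * key
    - (D i (V 0) * Y 0 + D i (V 1) * Y 1 + D i (V 2) * Y 2 + algebraMap ℝ A ε * D i U) * h1 j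
    - (D j (V 0) * Y 0 + D j (V 1) * Y 1 + D j (V 2) * Y 2 + algebraMap ℝ A ε * D j U) * h1 i
    - h * (D i (V j) + D j (V i)) * hρ
    - h ^ 2 * ρ * s1 - h ^ 2 * ρ * s2 + D j h * s3 + D i h * s4

/-- The weights `1/a², 1/a², 1` of the coordinates `x, y, z`. -/
def weight (a : ℝ) : Fin 3 → ℝ := ![1 / a ^ 2, 1 / a ^ 2, 1]

theorem weight_pos {a : ℝ} (ha : 0 < a) (i : Fin 3) : 0 < weight a i := by
  fin_cases i <;> simp [weight] <;> positivity

theorem one_add_weight_sum_pos {a : ℝ} (ha : 0 < a) (y : Fin 3 → ℝ) :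
    0 < 1 + ∑ i, weight a i * y i ^ 2 := by
  have : 0 ≤ ∑ i, weight a i * y i ^ 2 :=
    Finset.sum_nonneg fun i _ => mul_nonneg (weight_pos ha i).le (sq_nonneg _)
  linarith

/-- Minus the support function of the central projection. -/
def negRadius (a : ℝ) (ha : 0 < a) : smoothFunctions 3 :=
  ⟨fun y => -√(1 + ∑ i, weight a i * y i ^ 2),
    (ContDiff.neg (ContDiff.sqrt (by fun_prop) fun y => (one_add_weight_sum_pos ha y).ne') :
      ContDiff ℝ ∞ fun y : Fin 3 → ℝ => -√(1 + ∑ i, weight a i * y i ^ 2))⟩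

/-- The scaling factor of the central projection. -/
def scaling (a : ℝ) (ha : 0 < a) : smoothFunctions 3 :=
  ⟨fun y => (√(1 + ∑ i, weight a i * y i ^ 2))⁻¹,
    (ContDiff.inv (ContDiff.sqrt (by fun_prop) fun y => (one_add_weight_sum_pos ha y).ne')
      (fun y => (Real.sqrt_pos.2 (one_add_weight_sum_pos ha y)).ne') :
      ContDiff ℝ ∞ fun y : Fin 3 → ℝ => (√(1 + ∑ i, weight a i * y i ^ 2))⁻¹)⟩

theorem scaling_mul_negRadius (a : ℝ) (ha : 0 < a) : scaling a ha * negRadius a ha = -1 := by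
  ext y
  have := (Real.sqrt_pos.2 (one_add_weight_sum_pos ha y)).ne'
  change (√(1 + ∑ i, weight a i * y i ^ 2))⁻¹ * -√(1 + ∑ i, weight a i * y i ^ 2) = -1
  field_simp

/-- Differentiating this polynomial identity once and twice gives the gradient and the Hessian
without differentiating the root. -/
theorem negRadius_sq (a : ℝ) (ha : 0 < a) :
    negRadius a ha * negRadius a ha = 1 + ∑ i, weight a i • (coordinate i * coordinate i) := by
  ext y
  have := Real.mul_self_sqrt (one_add_weight_sum_pos ha y).le
  simp only [pow_two] at this
  have e : (1 + ∑ i, weight a i • (coordinate i * coordinate i) : smoothFunctions 3).1 y =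
      1 + ∑ i, weight a i * (y i * y i) := by
    simp [coordinate_apply]
  rw [e, ← this]
  change -√(1 + ∑ i, weight a i * y i ^ 2) * -√(1 + ∑ i, weight a i * y i ^ 2) = _
  simp only [pow_two]
  ring

theorem negRadius_mul_partialDeriv (a : ℝ) (ha : 0 < a) (i : Fin 3) :
    negRadius a ha * partialDeriv i (negRadius a ha) = weight a i • coordinate i := by
  have h := congrArg (partialDeriv i) (negRadius_sq a ha)
  simp only [map_add, map_sum, Derivation.leibniz, Derivation.map_smul, partialDeriv_coordinate,
    Derivation.map_one_eq_zero, smul_eq_mul, mul_ite, mul_one, mul_zero, zero_add] at h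
  rw [Finset.sum_eq_single i (by intro j _ hj; simp [hj.symm]) (by simp)] at h
  simp only [if_true, ← two_mul] at h
  rw [Algebra.smul_def] at h ⊢
  have h2 : 2 * (negRadius a ha * partialDeriv i (negRadius a ha) -
      algebraMap ℝ _ (weight a i) * coordinate i) = 0 := by
    linear_combination h
  exact sub_eq_zero.1 (eq_zero_of_two_mul_eq_zero h2)

theorem negRadius_hessian (a : ℝ) (ha : 0 < a) (i j : Fin 3) :
    partialDeriv i (negRadius a ha) * partialDeriv j (negRadius a ha) +
      negRadius a ha * partialDeriv i (partialDeriv j (negRadius a ha)) =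
      weight a j • (if i = j then 1 else 0) := by
  have h := congrArg (partialDeriv i) (negRadius_mul_partialDeriv a ha j)
  simp only [Derivation.leibniz, Derivation.map_smul, partialDeriv_coordinate, smul_eq_mul] at h
  rw [← h]
  ring

theorem det_hessian_negRadius_ne_zero (a : ℝ) (ha : 0 < a) (y : Fin 3 → ℝ) :
    (Matrix.of fun i j : Fin 3 =>
      (partialDeriv i (partialDeriv j (negRadius a ha))).1 y).det ≠ 0 := by
  set r := (negRadius a ha).1 y with hr
  set n : Fin 3 → ℝ := fun i => (partialDeriv i (negRadius a ha)).1 y with hn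
  set H : Matrix (Fin 3) (Fin 3) ℝ := Matrix.of fun i j : Fin 3 =>
      (partialDeriv i (partialDeriv j (negRadius a ha))).1 y with hH
  have h1 : ∀ i, r * n i = weight a i * y i := fun i =>
    congrFun (congrArg Subtype.val (negRadius_mul_partialDeriv a ha i)) y
  have h2 : ∀ i j, n i * n j + r * H i j = weight a j * (if i = j then 1 else 0) := by
    intro i j
    have := congrFun (congrArg Subtype.val (negRadius_hessian a ha i j)) y
    refine Eq.trans this ?_
    split_ifs <;> rfl
  have hr0 : r ≠ 0 := neg_ne_zero.2 (Real.sqrt_pos.2 (one_add_weight_sum_pos ha y)).ne'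
  have hr2 : r ^ 2 = 1 + ∑ i, weight a i * y i ^ 2 := by
    rw [hr]
    change (-√(1 + ∑ i, weight a i * y i ^ 2)) ^ 2 = _
    rw [neg_sq, Real.sq_sqrt (one_add_weight_sum_pos ha y).le]
  have hn' : ∀ i, n i = weight a i * y i / r := fun i => by
    rw [eq_div_iff hr0, mul_comm]; exact h1 i
  have hH' : ∀ i j, H i j = (weight a j * (if i = j then 1 else 0) - n i * n j) / r :=
    fun i j => by rw [eq_div_iff hr0, ← h2 i j]; ring
  -- `H = (W - n nᵀ) / r` with `W` the diagonal matrix of weights and `n = W y / r`. The matrix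
  -- determinant lemma gives `det W * (1 - yᵀ W y / r²) / r³`, and `r² - yᵀ W y = 1`.
  have key : r ^ 5 * H.det = weight a 0 * weight a 1 * weight a 2 := by
    rw [Matrix.det_fin_three]
    simp only [hH', hn']
    simp only [Fin.sum_univ_three] at hr2
    simp
    field_simp
    linear_combination (weight a 0 * weight a 1 * weight a 2 * r ^ 4) * hr2
  intro h0
  rw [h0, mul_zero] at key
  have := mul_pos (mul_pos (weight_pos ha 0) (weight_pos ha 1)) (weight_pos ha 2)
  linarith

/-- The inverse of the central projection of a hemisphere `ε w > 0`. -/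
def hemisphere (a : ℝ) (ha : 0 < a) (ε : ℝ) (y : Fin 3 → ℝ) : EuclideanSpace ℝ (Fin 4) :=
  (scaling a ha).1 y • !₂[y 0, y 1, y 2, ε]

theorem hemisphere_mem {a : ℝ} (ha : 0 < a) {ε : ℝ} (hε : ε ^ 2 = 1) (y : Fin 3 → ℝ) :
    hemisphere a ha ε y ∈ ellipsoid a := by
  have hp := one_add_weight_sum_pos ha y
  have hs := Real.sq_sqrt hp.le
  have hs0 := Real.sqrt_pos.2 hp
  change (_ * y 0) ^ 2 + (_ * y 1) ^ 2 = a ^ 2 * (1 - (_ * y 2) ^ 2 - (_ * ε) ^ 2)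
  simp only [scaling]
  set s := √(1 + ∑ i, weight a i * y i ^ 2)
  simp only [Fin.sum_univ_three, weight, Matrix.cons_val] at hs
  field_simp
  field_simp at hs
  linear_combination -hs + a^2 * hε

theorem contDiff_hemisphere {a : ℝ} (ha : 0 < a) (ε : ℝ) :
    ContDiff ℝ ∞ (hemisphere a ha ε) := by
  refine (contDiff_coe (scaling a ha)).smul (contDiff_euclidean.2 fun i => ?_)
  fin_cases i <;> simp <;> fun_prop

/-- A component of a smooth map to `ℝ⁴`, as a smooth function. -/
def component {n : ℕ} {c : (Fin n → ℝ) → EuclideanSpace ℝ (Fin 4)} (hc : ContDiff ℝ ∞ c)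
    (k : Fin 4) : smoothFunctions n :=
  ⟨fun y => c y k, (contDiff_euclidean.1 hc k : ContDiff ℝ ∞ fun y => c y k)⟩

theorem partialDeriv_component {n : ℕ} {c : (Fin n → ℝ) → EuclideanSpace ℝ (Fin 4)}
    (hc : ContDiff ℝ ∞ c) (k : Fin 4) (i : Fin n) (y : Fin n → ℝ) :
    (partialDeriv i (component hc k)).1 y = (fderiv ℝ c y (Pi.single i 1)) k := by
  rw [partialDeriv_apply]
  have := ((EuclideanSpace.proj k : EuclideanSpace ℝ (Fin 4) →L[ℝ] ℝ).hasFDerivAt.comp y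
    (hc.differentiable (by simp) y).hasFDerivAt).fderiv
  exact congrArg (fun l => l (Pi.single i 1)) this

/-- An infinitesimal isometric deformation of an ellipsoid is affine and skew on a hemisphere. -/
theorem exists_affine_on_hemisphere {a : ℝ} (ha : 0 < a) {ε : ℝ} (hε : ε ^ 2 = 1)
    {G : EuclideanSpace ℝ (Fin 4) → EuclideanSpace ℝ (Fin 4)} (hG : ContDiff ℝ ∞ G)
    (hK : ∀ x ∈ ellipsoid a, ∀ v ∈ tangentSpace (ellipsoid a) x,
      ∀ w ∈ tangentSpace (ellipsoid a) x,
      inner ℝ (fderiv ℝ G x v) w = -inner ℝ (fderiv ℝ G x w) v) :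
    ∃ (c b : Fin 3 → ℝ) (s : ℝ) (L : Matrix (Fin 3) (Fin 3) ℝ), (∀ i j, L i j = -L j i) ∧
      ∀ y, (∀ i : Fin 3, (G (hemisphere a ha ε y)) i.castSucc =
          c i + (scaling a ha).1 y * (b i + ∑ j, L i j * y j)) ∧
        ε * (G (hemisphere a ha ε y)) 3 = s - (scaling a ha).1 y * ∑ j, b j * y j := by
  have hΦ := contDiff_hemisphere ha ε
  have hV : ContDiff ℝ ∞ (fun y => G (hemisphere a ha ε y)) := hG.comp hΦ
  have hcomp : ∀ y v, fderiv ℝ (fun y => G (hemisphere a ha ε y)) y v =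
      fderiv ℝ G (hemisphere a ha ε y) (fderiv ℝ (hemisphere a ha ε) y v) := by
    intro y v
    have := ((hG.differentiable (by simp) (hemisphere a ha ε y)).hasFDerivAt.comp y
      (hΦ.differentiable (by simp) y).hasFDerivAt).fderiv
    exact congrArg (fun l => l v) this
  have hkill : ∀ i j, ∑ k, partialDeriv i (component hV k) * partialDeriv j (component hΦ k)
      + ∑ k, partialDeriv j (component hV k) * partialDeriv i (component hΦ k) = 0 := by
    intro i j
    ext y
    have ht := fun v => fderiv_mem_tangentSpace (M := ellipsoid a)
      (hΦ.differentiable (by simp) y) (hemisphere_mem ha hε) v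
    have := hK _ (hemisphere_mem ha hε y) _ (ht (Pi.single i 1)) _ (ht (Pi.single j 1))
    rw [← hcomp, ← hcomp, PiLp.inner_apply, PiLp.inner_apply] at this
    simp only [RCLike.inner_apply, conj_trivial] at this
    simp [Finset.sum_apply, partialDeriv_component, mul_comm]
    linarith
  have hΦ' : ∀ k : Fin 3, component hΦ k.castSucc = scaling a ha * coordinate k := by
    intro k
    ext y
    fin_cases k <;> rfl
  have hΦ3 : component hΦ 3 = ε • scaling a ha := by
    ext y
    exact mul_comm _ _
  have hkill' : ∀ i j,
      (∑ k : Fin 3, partialDeriv i (component hV k.castSucc) *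
          partialDeriv j (scaling a ha * coordinate k)
        + partialDeriv i (component hV 3) * partialDeriv j (ε • scaling a ha))
      + (∑ k : Fin 3, partialDeriv j (component hV k.castSucc) *
          partialDeriv i (scaling a ha * coordinate k)
        + partialDeriv j (component hV 3) * partialDeriv i (ε • scaling a ha)) = 0 := by
    intro i j
    have := hkill i j
    rw [Fin.sum_univ_castSucc (n := 3), Fin.sum_univ_castSucc (n := 3)] at this
    simp only [hΦ'] at this
    rw [← hΦ3]
    exact this
  obtain ⟨c, b, s, L, hL, hS, hT⟩ := exists_affine_of_killing
    (killing_equation_of_central_projection ε partialDeriv_coordinate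
      (scaling_mul_negRadius a ha) hkill') (det_hessian_negRadius_ne_zero a ha)
  refine ⟨c, b, s, L, hL, fun y => ?_⟩
  have hρ : (scaling a ha).1 y * (negRadius a ha).1 y = -1 :=
    congrFun (congrArg Subtype.val (scaling_mul_negRadius a ha)) y
  have h1 : ∀ i : Fin 3, (G (hemisphere a ha ε y)) i.castSucc =
      c i + (scaling a ha).1 y * (b i + ∑ j, L i j * y j) := by
    intro i
    have : -((negRadius a ha).1 y * (G (hemisphere a ha ε y)) i.castSucc) =
      -c i * (negRadius a ha).1 y + b i + ∑ j, L i j * y j := hT i y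
    linear_combination (scaling a ha).1 y * this -
      (c i - (G (hemisphere a ha ε y)) i.castSucc) * hρ
  refine ⟨h1, ?_⟩
  -- The left side is the function `S` of the graph. After substituting `h1`, skewness gives `yᵀ L y
  -- = 0`, and the fourth component remains.
  have h2 : ∑ i : Fin 3, y i * (G (hemisphere a ha ε y)) i.castSucc +
      ε * (G (hemisphere a ha ε y)) 3 = s + ∑ j, c j * y j := by
    rw [← hS y]
    simp [component, coordinate_apply]
  simp only [h1, Fin.sum_univ_three] at h2 ⊢
  have e00 := hL 0 0
  have e11 := hL 1 1
  have e22 := hL 2 2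
  linear_combination h2 - (scaling a ha).1 y * (y 0 ^ 2 / 2 * e00 + y 1 ^ 2 / 2 * e11 +
    y 2 ^ 2 / 2 * e22 + y 0 * y 1 * hL 0 1 + y 0 * y 2 * hL 0 2 + y 1 * y 2 * hL 1 2)

/-- Dividing by `m = ε w` inverts the chart: the equation of the ellipsoid says `1 + ∑ wᵢ yᵢ² =
m⁻²`, so the scaling factor is `m`. -/
theorem exists_hemisphere_eq {a : ℝ} (ha : 0 < a) {ε : ℝ} (hε : ε ^ 2 = 1)
    {x : EuclideanSpace ℝ (Fin 4)} (hx : x ∈ ellipsoid a) (hx3 : 0 < ε * x 3) :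
    ∃ y, hemisphere a ha ε y = x := by
  have hx' : x 0 ^ 2 + x 1 ^ 2 = a ^ 2 * (1 - x 2 ^ 2 - x 3 ^ 2) := hx
  set m := ε * x 3 with hm
  have hm2 : m ^ 2 = x 3 ^ 2 := by rw [hm, mul_pow, hε, one_mul]
  have hx3' : x 3 = m * ε := by rw [hm]; linear_combination -(x 3) * hε
  set y : Fin 3 → ℝ := fun i => x i.castSucc / m with hy
  have hq : 1 + ∑ i, weight a i * y i ^ 2 = (m⁻¹) ^ 2 := by
    simp [Fin.sum_univ_three, weight, hy]
    field_simp
    linear_combination a ^ 2 * hm2 + hx'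
  have hρ : (scaling a ha).1 y = m := by
    change (√(1 + ∑ i, weight a i * y i ^ 2))⁻¹ = m
    rw [hq, Real.sqrt_sq (by positivity), inv_inv]
  refine ⟨y, ?_⟩
  ext i
  rw [hemisphere, hρ]
  fin_cases i
  · simp [hy]; field_simp
  · simp [hy]; field_simp
  · simp [hy]; field_simp
  · simp [hx3']

/-- A tangential infinitesimal isometric deformation of an ellipsoid is linear and skew on a
hemisphere. -/
theorem exists_skew_on_hemisphere {a : ℝ} (ha : 0 < a) {ε : ℝ} (hε : ε ^ 2 = 1)
    {G : EuclideanSpace ℝ (Fin 4) → EuclideanSpace ℝ (Fin 4)} (hG : ContDiff ℝ ∞ G)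
    (hT : ∀ x ∈ ellipsoid a, G x ∈ tangentSpace (ellipsoid a) x)
    (hK : ∀ x ∈ ellipsoid a, ∀ v ∈ tangentSpace (ellipsoid a) x,
      ∀ w ∈ tangentSpace (ellipsoid a) x,
      inner ℝ (fderiv ℝ G x v) w = -inner ℝ (fderiv ℝ G x w) v) :
    ∃ L : Matrix (Fin 4) (Fin 4) ℝ, (∀ i j, L i j = -L j i) ∧
      ∀ x ∈ ellipsoid a, 0 < ε * x 3 → ∀ i, G x i = ∑ j, L i j * x j := by
  obtain ⟨c, b, s, L, hL, hGy⟩ := exists_affine_on_hemisphere ha hε hG hK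
  have hLd : ∀ i, L i i = 0 := fun i => by linarith [hL i i]
  have hρ0 : ∀ y, 0 < (scaling a ha).1 y := fun y =>
    inv_pos.2 (Real.sqrt_pos.2 (one_add_weight_sum_pos ha y))
  have htan : ∀ y, ∑ i, weight a i * y i * (c i + (scaling a ha).1 y * (b i + ∑ j, L i j * y j)) +
      (s - (scaling a ha).1 y * ∑ j, b j * y j) = 0 := by
    intro y
    have h := (mem_tangentSpace_ellipsoid a ha _ (hemisphere_mem ha hε y) _).1
      (hT _ (hemisphere_mem ha hε y))
    obtain ⟨h1, h2⟩ := hGy y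
    rw [← h2]
    simp only [← h1]
    have e : ∀ i : Fin 4, hemisphere a ha ε y i = (scaling a ha).1 y *
      (!₂[y 0, y 1, y 2, ε] : EuclideanSpace ℝ (Fin 4)) i := fun i => rfl
    simp only [e] at h
    simp [Fin.sum_univ_three, weight] at h ⊢
    have h0 := (hρ0 y).ne'
    field_simp
    apply mul_left_cancel₀ h0
    linear_combination h
  -- Tangency at the pole `y = 0` excludes vertical translation.
  have hs : s = 0 := by
    have := htan 0
    simpa using this
  have hc : ∀ i, c i = 0 := by
    intro i
    -- Tangency along the axis `y = t eᵢ`. The scaling factor takes different values at `t = 1` and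
    -- `t = 2`, so both summands vanish; this holds even where `weight a i = 1`.
    have ht : ∀ t : ℝ, t ≠ 0 → weight a i * c i +
        (√(1 + weight a i * t ^ 2))⁻¹ * ((weight a i - 1) * b i) = 0 := by
      intro t ht
      have h := htan (Pi.single i t)
      have hr : (scaling a ha).1 (Pi.single i t) = (√(1 + weight a i * t ^ 2))⁻¹ := by
        change (√(1 + ∑ j, weight a j * (Pi.single i t : Fin 3 → ℝ) j ^ 2))⁻¹ = _
        rw [Finset.sum_eq_single i (by intro j _ hj; simp [hj]) (by simp)]
        simp
      rw [hr, Finset.sum_eq_single i (by intro j _ hj; simp [hj]) (by simp),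
        Finset.sum_eq_single i (by intro j _ hj; simp [hj]) (by simp),
        Finset.sum_eq_single i (by intro j _ hj; simp [hj]) (by simp), hLd, hs] at h
      simp only [Pi.single_eq_same] at h
      apply mul_left_cancel₀ ht
      linear_combination h
    have h1 := ht 1 one_ne_zero
    have h2 := ht 2 two_ne_zero
    have hw := weight_pos ha i
    have hlt : √(1 + weight a i * 1 ^ 2) < √(1 + weight a i * 2 ^ 2) :=
      Real.sqrt_lt_sqrt (by positivity) (by linarith)
    have hne : (√(1 + weight a i * 1 ^ 2))⁻¹ - (√(1 + weight a i * 2 ^ 2))⁻¹ ≠ 0 := by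
      rw [sub_ne_zero]
      exact fun h => hlt.ne (inv_injective h)
    have hb : (weight a i - 1) * b i = 0 := by
      apply mul_left_cancel₀ hne
      linear_combination h1 - h2
    rw [hb, mul_zero, add_zero] at h1
    exact (mul_eq_zero.1 h1).resolve_left hw.ne'
  refine ⟨!![L 0 0, L 0 1, L 0 2, ε * b 0; L 1 0, L 1 1, L 1 2, ε * b 1;
    L 2 0, L 2 1, L 2 2, ε * b 2; -(ε * b 0), -(ε * b 1), -(ε * b 2), 0], ?_, ?_⟩
  · intro i j
    fin_cases i <;> fin_cases j <;> simp [hLd] <;> exact hL _ _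
  · intro x hx hx3
    obtain ⟨y, rfl⟩ := exists_hemisphere_eq ha hε hx hx3
    obtain ⟨h1, h2⟩ := hGy y
    have e : ∀ i : Fin 4, hemisphere a ha ε y i = (scaling a ha).1 y *
      (!₂[y 0, y 1, y 2, ε] : EuclideanSpace ℝ (Fin 4)) i := fun i => rfl
    have e0 := h1 0
    have e1 := h1 1
    have e2 := h1 2
    simp only [hc, hs, Fin.sum_univ_three] at e0 e1 e2 h2
    intro i
    rw [Fin.sum_univ_four]
    simp only [e]
    fin_cases i
    · refine e0.trans ?_
      simp
      linear_combination -(scaling a ha).1 y * b 0 * hε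
    · refine e1.trans ?_
      simp
      linear_combination -(scaling a ha).1 y * b 1 * hε
    · refine e2.trans ?_
      simp
      linear_combination -(scaling a ha).1 y * b 2 * hε
    · simp
      linear_combination ε * h2 - (G (hemisphere a ha ε y)) 3 * hε

/-- A tangential infinitesimal isometric deformation of an ellipsoid is linear and skew. -/
theorem exists_skew_of_infinitesimal_isometry {a : ℝ} (ha : 0 < a)
    {G : EuclideanSpace ℝ (Fin 4) → EuclideanSpace ℝ (Fin 4)} (hG : ContDiff ℝ ∞ G)
    (hT : ∀ x ∈ ellipsoid a, G x ∈ tangentSpace (ellipsoid a) x)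
    (hK : ∀ x ∈ ellipsoid a, ∀ v ∈ tangentSpace (ellipsoid a) x,
      ∀ w ∈ tangentSpace (ellipsoid a) x,
      inner ℝ (fderiv ℝ G x v) w = -inner ℝ (fderiv ℝ G x w) v) :
    ∃ L : Matrix (Fin 4) (Fin 4) ℝ, (∀ i j, L i j = -L j i) ∧
      ∀ x ∈ ellipsoid a, ∀ i, G x i = ∑ j, L i j * x j := by
  -- continuity extends the formula of a hemisphere to the equator
  have hequator : ∀ ε : ℝ, ε ^ 2 = 1 → ∀ L : Matrix (Fin 4) (Fin 4) ℝ,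
      (∀ x ∈ ellipsoid a, 0 < ε * x 3 → ∀ i, G x i = ∑ j, L i j * x j) →
      ∀ x ∈ ellipsoid a, x 3 = 0 → ∀ i, G x i = ∑ j, L i j * x j := by
    intro ε hε L hL x hx hx3 i
    have hx' : x 0 ^ 2 + x 1 ^ 2 = a ^ 2 * (1 - x 2 ^ 2 - x 3 ^ 2) := hx
    -- An arc of the ellipsoid from `x` into the hemisphere `ε w > 0`, where it stays for `0 < t <
    -- π`.
    let c : ℝ → EuclideanSpace ℝ (Fin 4) := fun t =>
      Real.cos t • x + Real.sin t • !₂[0, 0, 0, ε]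
    have hc : Continuous c := by fun_prop
    have hcM : ∀ t, c t ∈ ellipsoid a := by
      intro t
      change (c t 0) ^ 2 + (c t 1) ^ 2 = a ^ 2 * (1 - (c t 2) ^ 2 - (c t 3) ^ 2)
      simp only [c]
      simp [hx3] at hx' ⊢
      linear_combination Real.cos t ^ 2 * hx' + a ^ 2 * Real.sin_sq_add_cos_sq t +
        a ^ 2 * Real.sin t ^ 2 * hε
    let d : ℝ → ℝ := fun t => G (c t) i - ∑ j, L i j * c t j
    have hd : Continuous d := by
      have : Continuous fun t => G (c t) := hG.continuous.comp hc
      fun_prop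
    have h0 : ∀ t ∈ Set.Ioo 0 Real.pi, d t = 0 := by
      intro t ht
      refine sub_eq_zero.2 (hL _ (hcM t) ?_ i)
      have : ε * c t 3 = Real.sin t := by
        simp only [c]
        simp [hx3]
        linear_combination Real.sin t * hε
      rw [this]
      exact Real.sin_pos_of_mem_Ioo ht
    have hcl : closure (Set.Ioo 0 Real.pi) ⊆ {t | d t = 0} :=
      closure_minimal h0 (isClosed_eq hd continuous_const)
    rw [closure_Ioo Real.pi_pos.ne] at hcl
    have := hcl ⟨le_rfl, Real.pi_pos.le⟩
    have hc0 : c 0 = x := by simp [c]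
    have h2 : G (c 0) i - ∑ j, L i j * c 0 j = 0 := this
    rw [hc0] at h2
    exact sub_eq_zero.1 h2
  obtain ⟨L, hLs, hL⟩ := exists_skew_on_hemisphere ha (one_pow 2) hG hT hK
  obtain ⟨L', hLs', hL'⟩ := exists_skew_on_hemisphere ha (ε := -1) (by norm_num) hG hT hK
  -- The axis points on the equator fix the first three columns; skewness then fixes the last one.
  have hcol : ∀ j : Fin 4, j ≠ 3 → ∀ i, L i j = L' i j := by
    intro j hj i
    have key : ∀ r : ℝ, r ≠ 0 → (EuclideanSpace.single j r) ∈ ellipsoid a → L i j = L' i j := by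
      intro r hr hm
      have h1 := hequator 1 (one_pow 2) L hL _ hm (by simp [hj.symm]) i
      have h2 := hequator (-1) (by norm_num) L' hL' _ hm (by simp [hj.symm]) i
      rw [h1] at h2
      simpa [hr] using h2
    fin_cases j
    · exact key a ha.ne' (by simp [ellipsoid])
    · exact key a ha.ne' (by simp [ellipsoid])
    · exact key 1 one_ne_zero (by simp [ellipsoid])
    · exact absurd rfl hj
  have hLL : L = L' := by
    ext i j
    by_cases hj : j = 3
    · by_cases hi : i = 3
      · rw [hi, hj]
        linarith [hLs 3 3, hLs' 3 3]
      · rw [hLs i j, hLs' i j, hj, hcol i hi]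
    · exact hcol j hj i
  refine ⟨L, hLs, fun x hx => ?_⟩
  rcases lt_trichotomy (x 3) 0 with h | h | h
  · rw [hLL]
    exact hL' x hx (by linarith)
  · exact hequator 1 (one_pow 2) L hL x hx h
  · exact hL x hx (by linarith)

/-- Killing fields of an ellipsoid are linear and skew. -/
theorem IsKilling.exists_skew {a : ℝ} (ha : 0 < a) {X : VectorField (ellipsoid a)}
    (hX : IsKilling X) :
    ∃ L : Matrix (Fin 4) (Fin 4) ℝ, (∀ i j, L i j = -L j i) ∧
      ∀ (x : ellipsoid a) (i : Fin 4),
        (X.val x : EuclideanSpace ℝ (Fin 4)) i = ∑ j, L i j * (x : EuclideanSpace ℝ (Fin 4)) j := by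
  obtain ⟨G, hG, hGX⟩ := X.smooth
  obtain ⟨L, hLs, hL⟩ := exists_skew_of_infinitesimal_isometry ha hG
    (fun x hx => by
      have := hGX ⟨x, hx⟩
      simp only at this
      rw [this]
      exact (X.val ⟨x, hx⟩).2)
    (fun x hx v hv w hw => by
      have := hX ⟨x, hx⟩ ⟨v, hv⟩ ⟨w, hw⟩
      rwa [inner_nabla X hG hGX, inner_nabla X hG hGX] at this)
  refine ⟨L, hLs, fun x i => ?_⟩
  rw [← hL x x.2 i, hGX x]

/-- The rotation fields of the ellipsoid. -/
def rotation (p q : ℝ) (u : EuclideanSpace ℝ (Fin 4)) : EuclideanSpace ℝ (Fin 4) :=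
  p • dXi u + q • dMu u

theorem rotation_eq (p q : ℝ) (u : EuclideanSpace ℝ (Fin 4)) :
    rotation p q u = !₂[-p * u 1, p * u 0, -q * u 3, q * u 2] := by
  ext i
  fin_cases i <;> simp [rotation, dXi, dMu]

/-- If the axes are different, Killing fields are rotation fields. -/
theorem IsKilling.exists_rotation {a : ℝ} (ha : 0 < a) (ha1 : a ≠ 1)
    {X : VectorField (ellipsoid a)} (hX : IsKilling X) :
    ∃ p q : ℝ, ∀ x : ellipsoid a, (X.val x : EuclideanSpace ℝ (Fin 4)) = rotation p q x := by
  obtain ⟨L, hLs, hL⟩ := hX.exists_skew ha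
  have hne : 1 - a ^ 2 ≠ 0 := by
    intro h
    have : (a - 1) * (a + 1) = 0 := by linear_combination -h
    rcases mul_eq_zero.1 this with h | h
    · exact ha1 (by linarith)
    · linarith
  have hd : ∀ i, L i i = 0 := fun i => by linarith [hLs i i]
  have htan : ∀ x : ellipsoid a, _ := fun x =>
    (mem_tangentSpace_ellipsoid a ha x x.2 _).1 (X.val x).2
  simp only [hL, Fin.sum_univ_four] at htan
  have hs := Real.sq_sqrt (show (0 : ℝ) ≤ 2 by norm_num)
  have hs0 : √2 ≠ 0 := by positivity
  -- At a point midway between two axes of lengths `a` and `1`, tangency reads `a (1 - a²) L 0 2 =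
  -- 0`. The other three mixed entries are treated alike.
  have h02 : L 0 2 = 0 := by
    have := htan ⟨!₂[a / √2, 0, 1 / √2, 0], by
      simp [ellipsoid, div_pow, hs]; ring⟩
    simp [hd] at this
    rw [hLs 2 0] at this
    field_simp at this
    apply mul_left_cancel₀ (mul_ne_zero ha.ne' hne)
    linear_combination this
  have h03 : L 0 3 = 0 := by
    have := htan ⟨!₂[a / √2, 0, 0, 1 / √2], by
      simp [ellipsoid, div_pow, hs]; ring⟩
    simp [hd] at this
    rw [hLs 3 0] at this
    field_simp at this
    apply mul_left_cancel₀ (mul_ne_zero ha.ne' hne)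
    linear_combination this
  have h12 : L 1 2 = 0 := by
    have := htan ⟨!₂[0, a / √2, 1 / √2, 0], by
      simp [ellipsoid, div_pow, hs]; ring⟩
    simp [hd] at this
    rw [hLs 2 1] at this
    field_simp at this
    apply mul_left_cancel₀ (mul_ne_zero ha.ne' hne)
    linear_combination this
  have h13 : L 1 3 = 0 := by
    have := htan ⟨!₂[0, a / √2, 0, 1 / √2], by
      simp [ellipsoid, div_pow, hs]; ring⟩
    simp [hd] at this
    rw [hLs 3 1] at this
    field_simp at this
    apply mul_left_cancel₀ (mul_ne_zero ha.ne' hne)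
    linear_combination this
  refine ⟨L 1 0, L 3 2, fun x => ?_⟩
  rw [rotation_eq]
  ext i
  rw [hL, Fin.sum_univ_four]
  fin_cases i
  · simp [hd, h02, h03, hLs 0 1]
  · simp [hd, h12, h13]
  · simp [hd, hLs 2 0, hLs 2 1, h02, h12, hLs 2 3]
  · simp [hd, hLs 3 0, hLs 3 1, h03, h13]

/-! ### Zonal flows along rotation fields -/

/-- The rotation fields as continuous linear maps. -/
def rotationL (p q : ℝ) : EuclideanSpace ℝ (Fin 4) →L[ℝ] EuclideanSpace ℝ (Fin 4) :=
  LinearMap.toContinuousLinearMap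
    { toFun := rotation p q
      map_add' := fun u v => by
        ext i
        fin_cases i <;> simp [rotation_eq] <;> ring
      map_smul' := fun c u => by
        ext i
        fin_cases i <;> simp [rotation_eq] <;> ring }

theorem rotationL_apply (p q : ℝ) (u : EuclideanSpace ℝ (Fin 4)) :
    rotationL p q u = rotation p q u := rfl

theorem inner_coord (u v : EuclideanSpace ℝ (Fin 4)) :
    inner ℝ u v = u 0 * v 0 + u 1 * v 1 + u 2 * v 2 + u 3 * v 3 := by
  rw [PiLp.inner_apply, Fin.sum_univ_four]
  simp [mul_comm]

theorem rotation_mem_tangentSpace {a : ℝ} (ha : 0 < a) (p q : ℝ) {x : EuclideanSpace ℝ (Fin 4)}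
    (hx : x ∈ ellipsoid a) : rotation p q x ∈ tangentSpace (ellipsoid a) x := by
  rw [mem_tangentSpace_ellipsoid a ha x hx, rotation_eq]
  simp
  ring

/-- The rotation fields as vector fields on the ellipsoid. -/
def rotationField (a : ℝ) (ha : 0 < a) (p q : ℝ) : VectorField (ellipsoid a) where
  val x := ⟨rotation p q x, rotation_mem_tangentSpace ha p q x.2⟩
  smooth := ⟨rotationL p q, (rotationL p q).contDiff, fun _ => rfl⟩

theorem isKilling_rotationField (a : ℝ) (ha : 0 < a) (p q : ℝ) :
    IsKilling (rotationField a ha p q) := by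
  intro x v w
  rw [inner_nabla _ (rotationL p q).contDiff (fun _ => rfl),
    inner_nabla _ (rotationL p q).contDiff (fun _ => rfl), ContinuousLinearMap.fderiv,
    rotationL_apply, rotationL_apply, inner_coord, inner_coord, rotation_eq, rotation_eq]
  simp
  ring

/-- With `R` the linear map of the rotation field, the ambient derivative of `F R` along itself is
`F² R² x + F dF(R x) R x`. -/
theorem inner_nabla_smul_rotation {a p q : ℝ} {Z : VectorField (ellipsoid a)}
    {F : EuclideanSpace ℝ (Fin 4) → ℝ} (hF : ContDiff ℝ ∞ F)
    (hZ : ∀ x : ellipsoid a, (Z.val x : EuclideanSpace ℝ (Fin 4)) = F x • rotation p q x)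
    (x : ellipsoid a) (w : tangentSpace (ellipsoid a) (x : EuclideanSpace ℝ (Fin 4))) :
    inner ℝ (nabla Z x (Z.val x)) w =
      F x ^ 2 * inner ℝ (rotation p q (rotation p q x)) (w : EuclideanSpace ℝ (Fin 4)) +
      F x * fderiv ℝ F x (rotation p q x) *
        inner ℝ (rotation p q x) (w : EuclideanSpace ℝ (Fin 4)) := by
  have hg : ContDiff ℝ ∞ fun y => F y • rotationL p q y := hF.smul (rotationL p q).contDiff
  rw [inner_nabla Z hg (fun y => (hZ y).symm), hZ,
    fderiv_fun_smul (hF.differentiable (by simp) _) (rotationL p q).differentiableAt,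
    ContinuousLinearMap.fderiv]
  simp only [add_apply, smul_apply,
    ContinuousLinearMap.smulRight_apply, map_smul, rotationL_apply, inner_add_left,
    inner_smul_left, conj_trivial]
  ring

/-- The coordinate field `∂_χ` in Hopf coordinates. -/
def dChi (a ξ μ χ : ℝ) : EuclideanSpace ℝ (Fin 4) :=
  !₂[a * Real.cos ξ * Real.cos χ, a * Real.sin ξ * Real.cos χ,
    -(Real.cos μ * Real.sin χ), -(Real.sin μ * Real.sin χ)]

theorem hasDerivAt_hopf_chi (a ξ μ χ : ℝ) :
    HasDerivAt (fun t => hopf a ξ μ t) (dChi a ξ μ χ) χ := by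
  apply hasDerivAt_of_coord
  intro i
  fin_cases i
  · simpa [hopf, dChi] using (Real.hasDerivAt_sin χ).const_mul (a * Real.cos ξ)
  · simpa [hopf, dChi] using (Real.hasDerivAt_sin χ).const_mul (a * Real.sin ξ)
  · simpa [hopf, dChi] using (Real.hasDerivAt_cos χ).const_mul (Real.cos μ)
  · simpa [hopf, dChi] using (Real.hasDerivAt_cos χ).const_mul (Real.sin μ)

theorem dChi_mem_tangentSpace (a ξ μ χ : ℝ) :
    dChi a ξ μ χ ∈ tangentSpace (ellipsoid a) (hopf a ξ μ χ) :=
  hasDerivAt_mem_tangentSpace (hasDerivAt_hopf_chi a ξ μ χ) fun s => hopf_mem a ξ μ s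

theorem inner_rotation_dChi (p q a ξ μ χ : ℝ) :
    inner ℝ (rotation p q (hopf a ξ μ χ)) (dChi a ξ μ χ) = 0 := by
  rw [inner_coord, rotation_eq]
  simp [hopf, dChi]
  ring

/-- This is `-½ ∂_χ |X|²` for `|X|² = a² p² sin² χ + q² cos² χ`. -/
theorem inner_rotation_rotation_dChi (p q a ξ μ χ : ℝ) :
    inner ℝ (rotation p q (rotation p q (hopf a ξ μ χ))) (dChi a ξ μ χ) =
      (q ^ 2 - a ^ 2 * p ^ 2) * (Real.sin χ * Real.cos χ) := by
  rw [inner_coord, rotation_eq p q (rotation p q _), rotation_eq]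
  simp [hopf, dChi]
  linear_combination (-(a ^ 2 * p ^ 2 * Real.sin χ * Real.cos χ)) * Real.sin_sq_add_cos_sq ξ +
    q ^ 2 * Real.sin χ * Real.cos χ * Real.sin_sq_add_cos_sq μ

/-- The Hopf coordinates cover the ellipsoid. -/
theorem exists_hopf_eq {a : ℝ} (ha : 0 < a) {x : EuclideanSpace ℝ (Fin 4)}
    (hx : x ∈ ellipsoid a) : ∃ ξ μ, hopf a ξ μ (chi x) = x := by
  have hx' : x 0 ^ 2 + x 1 ^ 2 = a ^ 2 * (1 - x 2 ^ 2 - x 3 ^ 2) := hx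
  set r := √(x 2 ^ 2 + x 3 ^ 2) with hr
  have hr2 : r ^ 2 = x 2 ^ 2 + x 3 ^ 2 := Real.sq_sqrt (by positivity)
  have hr0 : 0 ≤ r := Real.sqrt_nonneg _
  have hr1 : r ^ 2 ≤ 1 := by
    have : 0 ≤ a ^ 2 * (1 - r ^ 2) := by
      rw [hr2, ← sub_sub, ← hx']
      positivity
    have := nonneg_of_mul_nonneg_right this (by positivity)
    linarith
  have hc : Real.cos (chi x) = r := Real.cos_arccos (by linarith) (by nlinarith)
  have hs : a * Real.sin (chi x) = √(x 0 ^ 2 + x 1 ^ 2) := by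
    rw [chi, Real.sin_arccos, hx', ← hr, Real.sqrt_mul (by positivity), Real.sqrt_sq ha.le, hr2,
      sub_sub]
  have hn : ∀ s t : ℝ, ‖(⟨s, t⟩ : ℂ)‖ = √(s ^ 2 + t ^ 2) := fun s t => by
    rw [Complex.norm_def, Complex.normSq_mk, pow_two, pow_two]
  refine ⟨(⟨x 0, x 1⟩ : ℂ).arg, (⟨x 2, x 3⟩ : ℂ).arg, ?_⟩
  have e0 := Complex.norm_mul_cos_arg ⟨x 0, x 1⟩
  have e1 := Complex.norm_mul_sin_arg ⟨x 0, x 1⟩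
  have e2 := Complex.norm_mul_cos_arg ⟨x 2, x 3⟩
  have e3 := Complex.norm_mul_sin_arg ⟨x 2, x 3⟩
  rw [hn] at e0 e1 e2 e3
  rw [← hs] at e0 e1
  rw [← hr, ← hc] at e2 e3
  simp only at e0 e1 e2 e3
  ext i
  fin_cases i
  · simp [hopf]; linear_combination e0
  · simp [hopf]; linear_combination e1
  · simp [hopf]; linear_combination e2
  · simp [hopf]; linear_combination e3

theorem continuous_hopf {α : Type*} [TopologicalSpace α] (a : ℝ) {ξ μ χ : α → ℝ}
    (hξ : Continuous ξ) (hμ : Continuous μ) (hχ : Continuous χ) :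
    Continuous fun c => hopf a (ξ c) (μ c) (χ c) := by
  unfold hopf
  fun_prop

theorem chi_mem_Icc (x : EuclideanSpace ℝ (Fin 4)) : chi x ∈ Set.Icc 0 (Real.pi / 2) :=
  ⟨Real.arccos_nonneg _, Real.arccos_le_pi_div_two.2 (Real.sqrt_nonneg _)⟩

theorem eqOn_Icc_of_eqOn_Ioo {s t : ℝ} (hst : s < t) {g h : ℝ → ℝ} (hg : Continuous g)
    (hh : Continuous h) (hgh : Set.EqOn g h (Set.Ioo s t)) : Set.EqOn g h (Set.Icc s t) := by
  rw [← closure_Ioo hst.ne]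
  exact closure_minimal hgh (isClosed_eq hg hh)

/-- A continuous function with constant square cannot change sign on a connected space. This
recovers the factor of a zonal flow from its square. -/
theorem eq_of_sq_eq_sq {α : Type*} [TopologicalSpace α] [PreconnectedSpace α] {g : α → ℝ}
    (hg : Continuous g) (c : α) (hsq : ∀ x, g x ^ 2 = g c ^ 2) (x : α) : g x = g c := by
  by_cases h0 : g c = 0
  · have := hsq x
    rw [h0] at this ⊢
    simpa using this
  · rcases isPreconnected_univ.eq_or_eq_neg_of_sq_eq (g := fun _ => g c)
      hg.continuousOn continuousOn_const (fun y _ => hsq y) (fun _ => h0) with h | h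
    · exact h (Set.mem_univ x)
    · have h2 : g c = -g c := h (Set.mem_univ c)
      exact absurd (by linarith) h0

/-- `R²` is radial in each coordinate plane, whereas rotation fields are tangent to the circles
there. Hence the pressure is invariant under the whole torus. -/
theorem inner_rotation_rotation_rotation (p q p' q' : ℝ) (u : EuclideanSpace ℝ (Fin 4)) :
    inner ℝ (rotation p q (rotation p q u)) (rotation p' q' u) = 0 := by
  rw [inner_coord, rotation_eq p q (rotation p q _), rotation_eq, rotation_eq]
  simp
  ring

theorem sin_mul_cos_pos {χ : ℝ} (hχ : χ ∈ Set.Ioo 0 (Real.pi / 2)) :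
    0 < Real.sin χ * Real.cos χ :=
  mul_pos (Real.sin_pos_of_pos_of_lt_pi hχ.1 (by linarith [hχ.2, Real.pi_pos]))
    (Real.cos_pos_of_mem_Ioo ⟨by linarith [hχ.1, Real.pi_pos], hχ.2⟩)

/-- If `∇_Z Z` is a gradient and `f` is invariant along `X = p ∂_ξ + q ∂_μ`, then the factor `f`
of the field `Z = f X` depends only on `χ`. -/
theorem factor_eq_of_chi {a p q : ℝ} (ha : 0 < a) (hpq : a ^ 2 * p ^ 2 ≠ q ^ 2)
    {Z : VectorField (ellipsoid a)} {F : EuclideanSpace ℝ (Fin 4) → ℝ} (hF : ContDiff ℝ ∞ F)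
    (hZ : ∀ x : ellipsoid a, (Z.val x : EuclideanSpace ℝ (Fin 4)) = F x • rotation p q x)
    (hdiv : ∀ x : ellipsoid a, fderiv ℝ F x (rotation p q x) = 0)
    {P : ellipsoid a → ℝ} (hP : IsSmooth (ellipsoid a) P)
    (hgrad : ∀ x, nabla Z x (Z.val x) = -grad P x) {x : EuclideanSpace ℝ (Fin 4)}
    (hx : x ∈ ellipsoid a) : F x = F (hopf a 0 0 (chi x)) := by
  obtain ⟨Q, hQ, hQP⟩ := hP
  have hdQ : ∀ (y : ellipsoid a) (w : tangentSpace (ellipsoid a) (y : EuclideanSpace ℝ (Fin 4))),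
      fderiv ℝ Q y w =
      -(F y ^ 2 * inner ℝ (rotation p q (rotation p q y)) (w : EuclideanSpace ℝ (Fin 4))) := by
    intro y w
    rw [← inner_grad P hQ hQP, ← neg_eq_iff_eq_neg, ← inner_neg_left, ← hgrad,
      inner_nabla_smul_rotation hF hZ, hdiv]
    ring
  have hQd : Differentiable ℝ Q := hQ.differentiable (by simp)
  have hrot : ∀ (p' q' : ℝ) (y : ellipsoid a), fderiv ℝ Q y (rotation p' q' y) = 0 := by
    intro p' q' y
    rw [hdQ y ⟨_, rotation_mem_tangentSpace ha p' q' y.2⟩, inner_rotation_rotation_rotation,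
      mul_zero, neg_zero]
  have hξ : ∀ ξ μ χ, Q (hopf a ξ μ χ) = Q (hopf a 0 μ χ) := by
    intro ξ μ χ
    have hd : ∀ t, HasDerivAt (fun t => Q (hopf a t μ χ)) 0 t := by
      intro t
      have h := (hQd (hopf a t μ χ)).hasFDerivAt.comp_hasDerivAt t (hasDerivAt_hopf_xi a t μ χ)
      have h0 := hrot 1 0 ⟨_, hopf_mem a t μ χ⟩
      rw [rotation, one_smul, zero_smul, add_zero] at h0
      rwa [h0] at h
    exact is_const_of_deriv_eq_zero (fun t => (hd t).differentiableAt) (fun t => (hd t).deriv) ξ 0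
  have hμ : ∀ ξ μ χ, Q (hopf a ξ μ χ) = Q (hopf a ξ 0 χ) := by
    intro ξ μ χ
    have hd : ∀ t, HasDerivAt (fun t => Q (hopf a ξ t χ)) 0 t := by
      intro t
      have h := (hQd (hopf a ξ t χ)).hasFDerivAt.comp_hasDerivAt t (hasDerivAt_hopf_mu a ξ t χ)
      have h0 := hrot 0 1 ⟨_, hopf_mem a ξ t χ⟩
      rw [rotation, one_smul, zero_smul, zero_add] at h0
      rwa [h0] at h
    exact is_const_of_deriv_eq_zero (fun t => (hd t).differentiableAt) (fun t => (hd t).deriv) μ 0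
  have hsq : ∀ ξ μ, ∀ χ ∈ Set.Ioo 0 (Real.pi / 2),
      F (hopf a ξ μ χ) ^ 2 = F (hopf a 0 0 χ) ^ 2 := by
    intro ξ μ χ hχ
    have hd : ∀ ξ μ, HasDerivAt (fun t => Q (hopf a ξ μ t))
        (-(F (hopf a ξ μ χ) ^ 2 * ((q ^ 2 - a ^ 2 * p ^ 2) * (Real.sin χ * Real.cos χ)))) χ := by
      intro ξ μ
      have h := (hQd (hopf a ξ μ χ)).hasFDerivAt.comp_hasDerivAt χ (hasDerivAt_hopf_chi a ξ μ χ)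
      have h0 := hdQ ⟨_, hopf_mem a ξ μ χ⟩ ⟨_, dChi_mem_tangentSpace a ξ μ χ⟩
      simp only [inner_rotation_rotation_dChi] at h0
      rwa [h0] at h
    have h1 := hd ξ μ
    have e : (fun t => Q (hopf a ξ μ t)) = fun t => Q (hopf a 0 0 t) :=
      funext fun t => by rw [hξ, hμ]
    rw [e] at h1
    -- The pressure is the same function of `χ` on all meridians, so its `χ`-derivatives agree;
    -- cancelling the common nonzero coefficient compares the values of `F²`.
    have h2 := h1.unique (hd 0 0)
    have hne : (q ^ 2 - a ^ 2 * p ^ 2) * (Real.sin χ * Real.cos χ) ≠ 0 :=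
      mul_ne_zero (sub_ne_zero.2 hpq.symm) (sin_mul_cos_pos hχ).ne'
    exact mul_right_cancel₀ hne (neg_injective h2)
  have hopen : ∀ ξ μ, ∀ χ ∈ Set.Ioo 0 (Real.pi / 2),
      F (hopf a ξ μ χ) = F (hopf a 0 0 χ) := by
    intro ξ μ χ hχ
    have hc : Continuous fun c : ℝ × ℝ => F (hopf a c.1 c.2 χ) :=
      hF.continuous.comp (continuous_hopf a continuous_fst continuous_snd continuous_const)
    exact eq_of_sq_eq_sq hc (0, 0) (fun c => hsq c.1 c.2 χ hχ) (ξ, μ)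
  obtain ⟨ξ, μ, hξμ⟩ := exists_hopf_eq ha hx
  have hc : ∀ ξ μ, Continuous fun χ => F (hopf a ξ μ χ) := fun ξ μ =>
    hF.continuous.comp (continuous_hopf a continuous_const continuous_const continuous_id)
  -- Continuity covers the two circles `χ = 0` and `χ = π/2`, where the coefficient vanishes.
  have h := eqOn_Icc_of_eqOn_Ioo (by positivity) (hc ξ μ) (hc 0 0)
    (fun χ hχ => hopen ξ μ χ hχ) (chi_mem_Icc x)
  simp only [hξμ] at h
  exact h

/-- If `a p = ± q`, the orbits of `p ∂_ξ + q ∂_μ` are geodesics. -/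
theorem nabla_eq_zero_of_sq_eq {a p q : ℝ} (ha : 0 < a) (hpq : a ^ 2 * p ^ 2 = q ^ 2)
    {Z : VectorField (ellipsoid a)} {F : EuclideanSpace ℝ (Fin 4) → ℝ} (hF : ContDiff ℝ ∞ F)
    (hZ : ∀ x : ellipsoid a, (Z.val x : EuclideanSpace ℝ (Fin 4)) = F x • rotation p q x)
    (hdiv : ∀ x : ellipsoid a, fderiv ℝ F x (rotation p q x) = 0) (x : ellipsoid a) :
    nabla Z x (Z.val x) = 0 := by
  refine ext_inner_right ℝ fun w => ?_
  rw [inner_nabla_smul_rotation hF hZ, hdiv, inner_zero_left, inner_coord,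
    rotation_eq p q (rotation p q _), rotation_eq]
  have hw := (mem_tangentSpace_ellipsoid a ha x x.2 w).1 w.2
  simp
  right
  -- `R² x = -(p² x₀, p² x₁, q² x₂, q² x₃)` is now `-p²` times the normal vector `(x₀, x₁, a² x₂, a²
  -- x₃)`.
  linear_combination (-p ^ 2) * hw + ((x : EuclideanSpace ℝ (Fin 4)) 2 *
    (w : EuclideanSpace ℝ (Fin 4)) 2 + (x : EuclideanSpace ℝ (Fin 4)) 3 *
    (w : EuclideanSpace ℝ (Fin 4)) 3) * hpq

/-- Non-geodesic zonal flows are directed along rotation fields, with a factor depending on `χ`. -/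
theorem IsNonGeodesicZonal.exists_factor {a : ℝ} (ha : 0 < a) (ha1 : a ≠ 1)
    {Z : VectorField (ellipsoid a)} (hZ : IsNonGeodesicZonal Z) :
    ∃ (p q : ℝ) (f : ℝ → ℝ), a ^ 2 * p ^ 2 ≠ q ^ 2 ∧
      IsSmooth (ellipsoid a) (fun x => f (chi x)) ∧
      ∀ x : ellipsoid a, (Z.val x : EuclideanSpace ℝ (Fin 4)) =
        f (chi x) • rotation p q x := by
  obtain ⟨hzonal, hng⟩ := hZ
  obtain ⟨⟨f, X, ⟨F, hF, hFf⟩, hX, hZX⟩, hdivZ, P, hP, hgrad⟩ := id hzonal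
  obtain ⟨p, q, hpq⟩ := hX.exists_rotation ha ha1
  have hdiv : ∀ x : ellipsoid a, fderiv ℝ F x (rotation p q x) = 0 := by
    intro x
    rw [← hpq, ← divergence_smul_killing hX hF (fun y => by rw [hZX, hFf]), hdivZ]
  have hZF : ∀ x : ellipsoid a, (Z.val x : EuclideanSpace ℝ (Fin 4)) = F x • rotation p q x := by
    intro x
    rw [hZX, hFf, ← hpq]
    rfl
  have hne : a ^ 2 * p ^ 2 ≠ q ^ 2 := fun h =>
    hng ⟨hzonal, nabla_eq_zero_of_sq_eq ha h hF hZF hdiv⟩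
  have hchi := fun x : ellipsoid a => factor_eq_of_chi ha hne hF hZF hdiv hP hgrad x.2
  exact ⟨p, q, fun χ => F (hopf a 0 0 χ), hne, ⟨F, hF, hchi⟩, fun x => by
    rw [hZF, hchi x]⟩

/-- If `a p ≠ ± q`, a nonzero flow with a factor depending on `χ` is not geodesic. -/
theorem exists_nabla_ne_zero {a p q : ℝ} (hpq : a ^ 2 * p ^ 2 ≠ q ^ 2)
    {Z : VectorField (ellipsoid a)} {f : ℝ → ℝ}
    (hf : IsSmooth (ellipsoid a) (fun x => f (chi x)))
    (hZ : ∀ x : ellipsoid a, (Z.val x : EuclideanSpace ℝ (Fin 4)) = f (chi x) • rotation p q x)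
    (h0 : ∃ x : ellipsoid a, f (chi x) ≠ 0) : ∃ x, nabla Z x (Z.val x) ≠ 0 := by
  obtain ⟨F, hF, hFf⟩ := hf
  have hZF : ∀ x : ellipsoid a, (Z.val x : EuclideanSpace ℝ (Fin 4)) = F x • rotation p q x := by
    intro x
    rw [hZ, hFf]
  have hFhopf : ∀ χ ∈ Set.Icc 0 (Real.pi / 2), F (hopf a 0 0 χ) = f χ := by
    intro χ hχ
    have := hFf ⟨_, hopf_mem a 0 0 χ⟩
    simp only [chi_hopf a 0 0 χ hχ.1 hχ.2] at this
    exact this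
  have hcont : Continuous fun χ : ℝ => F (hopf a 0 0 χ) :=
    hF.continuous.comp (continuous_hopf a continuous_const continuous_const continuous_id)
  by_contra! hall
  -- Pairing with `∂_χ`, which is orthogonal to the flow, isolates the `F²` term. One meridian
  -- suffices because the factor depends on `χ` only.
  have hzero : Set.EqOn (fun χ => F (hopf a 0 0 χ)) (fun _ => 0) (Set.Ioo 0 (Real.pi / 2)) := by
    intro χ hχ
    have h := inner_nabla_smul_rotation hF hZF ⟨_, hopf_mem a 0 0 χ⟩
      ⟨_, dChi_mem_tangentSpace a 0 0 χ⟩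
    rw [hall, inner_zero_left] at h
    simp only [inner_rotation_rotation_dChi, inner_rotation_dChi, mul_zero, add_zero] at h
    have hne : (q ^ 2 - a ^ 2 * p ^ 2) * (Real.sin χ * Real.cos χ) ≠ 0 :=
      mul_ne_zero (sub_ne_zero.2 hpq.symm) (sin_mul_cos_pos hχ).ne'
    exact pow_eq_zero_iff two_ne_zero |>.1 ((mul_eq_zero.1 h.symm).resolve_right hne)
  obtain ⟨x, hx⟩ := h0
  have h := eqOn_Icc_of_eqOn_Ioo (by positivity) hcont continuous_const hzero (chi_mem_Icc x)
  exact hx (by rw [← hFhopf _ (chi_mem_Icc x)]; exact h)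

/-! ### Circle actions by rotations -/

/-- Complex multiplication by `α` on the `(x, y)`-plane and by `β` on the `(z, w)`-plane. -/
def planeMul (α β : ℂ) (u : EuclideanSpace ℝ (Fin 4)) : EuclideanSpace ℝ (Fin 4) :=
  !₂[α.re * u 0 - α.im * u 1, α.im * u 0 + α.re * u 1,
    β.re * u 2 - β.im * u 3, β.im * u 2 + β.re * u 3]

theorem planeMul_one (u : EuclideanSpace ℝ (Fin 4)) : planeMul 1 1 u = u := by
  ext i
  fin_cases i <;> simp [planeMul]

theorem planeMul_mul (α α' β β' : ℂ) (u : EuclideanSpace ℝ (Fin 4)) :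
    planeMul (α * α') (β * β') u = planeMul α β (planeMul α' β' u) := by
  ext i
  fin_cases i <;> simp [planeMul] <;> ring

theorem planeMul_mem {a : ℝ} (α β : Circle) {u : EuclideanSpace ℝ (Fin 4)}
    (hu : u ∈ ellipsoid a) : planeMul α β u ∈ ellipsoid a := by
  have hα := Circle.normSq_coe α
  have hβ := Circle.normSq_coe β
  rw [Complex.normSq_apply] at hα hβ
  have hu' : u 0 ^ 2 + u 1 ^ 2 = a ^ 2 * (1 - u 2 ^ 2 - u 3 ^ 2) := hu
  simp [ellipsoid, planeMul]
  linear_combination hu' + (u 0 ^ 2 + u 1 ^ 2) * hα + a ^ 2 * (u 2 ^ 2 + u 3 ^ 2) * hβ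

/-- The circle action of weights `n` and `m`. -/
abbrev weightAction (a : ℝ) (n m : ℤ) : MulAction Circle (ellipsoid a) where
  smul θ x := ⟨planeMul (θ ^ n : Circle) (θ ^ m : Circle) x, planeMul_mem _ _ x.2⟩
  one_smul x := Subtype.ext (by
    change planeMul ((1 ^ n : Circle) : ℂ) ((1 ^ m : Circle) : ℂ) x = x
    rw [one_zpow, one_zpow, Circle.coe_one, planeMul_one])
  mul_smul θ η x := Subtype.ext (by
    change planeMul (((θ * η) ^ n : Circle) : ℂ) (((θ * η) ^ m : Circle) : ℂ) x =
      planeMul (θ ^ n : Circle) (θ ^ m : Circle) (planeMul (η ^ n : Circle) (η ^ m : Circle) x)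
    rw [mul_zpow, mul_zpow, Circle.coe_mul, Circle.coe_mul, planeMul_mul])

/-- Integral powers on the circle extend to smooth functions on the plane. -/
theorem exists_contDiff_zpow (n : ℤ) :
    ∃ e : ℂ → ℂ, ContDiff ℝ ∞ e ∧ ∀ θ : Circle, e θ = (θ ^ n : Circle) := by
  obtain ⟨k, rfl | rfl⟩ := n.eq_nat_or_neg
  · exact ⟨fun z => z ^ k, by fun_prop, fun θ => by simp⟩
  -- Conjugation equals inversion on the circle and, unlike inversion, is smooth at the origin.
  · refine ⟨fun z => Complex.conjCLE z ^ k, by fun_prop, fun θ => ?_⟩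
    rw [zpow_neg, zpow_natCast, ← inv_pow, Circle.coe_pow, Circle.coe_inv_eq_conj]
    rfl

theorem coe_exp_zpow (t : ℝ) (n : ℤ) :
    ((Circle.exp t ^ n : Circle) : ℂ) = Complex.exp ((n * t : ℝ) * Complex.I) := by
  rw [Circle.coe_zpow, Circle.coe_exp, ← Complex.exp_int_mul]
  push_cast
  ring_nf

theorem isInducedByCircleAction_rotationField (a : ℝ) (ha : 0 < a) (n m : ℤ) :
    IsInducedByCircleAction (rotationField a ha n m) := by
  refine ⟨weightAction a n m, ?_, ?_⟩
  · obtain ⟨e, he, hen⟩ := exists_contDiff_zpow n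
    obtain ⟨e', he', hen'⟩ := exists_contDiff_zpow m
    refine ⟨fun c => planeMul (e c.1) (e' c.1) c.2, ?_, fun θ x => ?_⟩
    · have h1 : ContDiff ℝ ∞ fun c : ℂ × EuclideanSpace ℝ (Fin 4) => (e c.1).re :=
        Complex.reCLM.contDiff.comp (he.comp contDiff_fst)
      have h2 : ContDiff ℝ ∞ fun c : ℂ × EuclideanSpace ℝ (Fin 4) => (e c.1).im :=
        Complex.imCLM.contDiff.comp (he.comp contDiff_fst)
      have h3 : ContDiff ℝ ∞ fun c : ℂ × EuclideanSpace ℝ (Fin 4) => (e' c.1).re :=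
        Complex.reCLM.contDiff.comp (he'.comp contDiff_fst)
      have h4 : ContDiff ℝ ∞ fun c : ℂ × EuclideanSpace ℝ (Fin 4) => (e' c.1).im :=
        Complex.imCLM.contDiff.comp (he'.comp contDiff_fst)
      refine contDiff_euclidean.2 fun i => ?_
      fin_cases i <;> simp [planeMul] <;> fun_prop
    · change planeMul (e θ) (e' θ) x = planeMul (θ ^ n : Circle) (θ ^ m : Circle) x
      rw [hen, hen']
  · intro x
    change HasDerivAt (fun t : ℝ => planeMul (Circle.exp t ^ n : Circle)
      (Circle.exp t ^ m : Circle) (x : EuclideanSpace ℝ (Fin 4))) (rotation n m x) 0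
    simp only [coe_exp_zpow, planeMul, Complex.exp_ofReal_mul_I_re, Complex.exp_ofReal_mul_I_im]
    have hc : ∀ k : ℝ, HasDerivAt (fun t => Real.cos (k * t)) 0 0 := fun k => by
      simpa using ((hasDerivAt_id (0 : ℝ)).const_mul k).cos
    have hs : ∀ k : ℝ, HasDerivAt (fun t => Real.sin (k * t)) k 0 := fun k => by
      simpa using ((hasDerivAt_id (0 : ℝ)).const_mul k).sin
    rw [rotation_eq]
    apply hasDerivAt_of_coord
    intro i
    fin_cases i
    · simpa using ((hc n).mul_const _).fun_sub ((hs n).mul_const _)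
    · simpa using ((hs n).mul_const _).fun_add ((hc n).mul_const _)
    · simpa using ((hc m).mul_const _).fun_sub ((hs m).mul_const _)
    · simpa using ((hs m).mul_const _).fun_add ((hc m).mul_const _)

/-- A periodic solution of a rotation equation has integral frequency. -/
theorem exists_int_of_rotating {p r : ℝ} (hr : r ≠ 0) {u v : ℝ → ℝ}
    (hu : ∀ t, HasDerivAt u (-p * v t) t) (hv : ∀ t, HasDerivAt v (p * u t) t)
    (hu0 : u 0 = r) (hu1 : u (2 * Real.pi) = r) (hv1 : v (2 * Real.pi) = 0) :
    ∃ n : ℤ, p = n := by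
  -- The component of `(u, v)` along the rotating vector `(cos pt, sin pt)` is conserved; comparing
  -- times `0` and `2π` gives `cos 2πp = 1`.
  have hd : ∀ t, HasDerivAt (fun t => Real.cos (p * t) * u t + Real.sin (p * t) * v t) 0 t := by
    intro t
    have hl : HasDerivAt (fun t => p * t) p t := by
      simpa using (hasDerivAt_id t).const_mul p
    refine ((hl.cos.mul (hu t)).add (hl.sin.mul (hv t))).congr_deriv ?_
    ring
  have h := is_const_of_deriv_eq_zero (fun t => (hd t).differentiableAt)
    (fun t => (hd t).deriv) (2 * Real.pi) 0
  simp only [hu0, hu1, hv1, mul_zero, Real.cos_zero, Real.sin_zero, zero_mul, add_zero,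
    one_mul] at h
  have hcos : Real.cos (p * (2 * Real.pi)) = 1 :=
    mul_right_cancel₀ hr (by rw [h, one_mul])
  obtain ⟨n, hn⟩ := (Real.cos_eq_one_iff _).1 hcos
  exact ⟨n, (mul_right_cancel₀ (by positivity) hn).symm⟩

/-- The group law propagates the velocity at time zero to the flow equation at all times. Orbits
close up after `2π`; one starting in each coordinate plane yields each integer. -/
theorem IsInducedByCircleAction.exists_int {a p q : ℝ} (ha : 0 < a)
    {X : VectorField (ellipsoid a)} (hX : IsInducedByCircleAction X)
    (hpq : ∀ x : ellipsoid a, (X.val x : EuclideanSpace ℝ (Fin 4)) = rotation p q x) :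
    (∃ n : ℤ, p = n) ∧ ∃ m : ℤ, q = m := by
  obtain ⟨act, -, hd⟩ := hX
  have hflow : ∀ (x : ellipsoid a) (t : ℝ), HasDerivAt
      (fun t : ℝ => ((act.smul (Circle.exp t) x : ellipsoid a) : EuclideanSpace ℝ (Fin 4)))
      (rotation p q (act.smul (Circle.exp t) x : ellipsoid a)) t := by
    intro x t
    have h := hd (act.smul (Circle.exp t) x)
    rw [hpq] at h
    have hadd : (fun s : ℝ => ((act.smul (Circle.exp s) x : ellipsoid a) :
        EuclideanSpace ℝ (Fin 4))) = fun s : ℝ => ((act.smul (Circle.exp (s - t))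
          (act.smul (Circle.exp t) x) : ellipsoid a) : EuclideanSpace ℝ (Fin 4)) := by
      funext s
      have := act.mul_smul (Circle.exp (s - t)) (Circle.exp t) x
      rw [← Circle.exp_add, sub_add_cancel] at this
      exact congrArg Subtype.val this
    rw [hadd]
    rw [← sub_self t] at h
    exact h.comp_sub_const t t
  have hcoord : ∀ (x : ellipsoid a) (t : ℝ) (i : Fin 4), HasDerivAt
      (fun t : ℝ => ((act.smul (Circle.exp t) x : ellipsoid a) : EuclideanSpace ℝ (Fin 4)) i)
      (rotation p q (act.smul (Circle.exp t) x : ellipsoid a) i) t := fun x t i =>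
    (EuclideanSpace.proj i : EuclideanSpace ℝ (Fin 4) →L[ℝ] ℝ).hasFDerivAt.comp_hasDerivAt t
      (hflow x t)
  simp only [rotation_eq] at hcoord
  have h0 : ∀ x : ellipsoid a, act.smul (Circle.exp 0) x = x := fun x => by
    rw [Circle.exp_zero]
    exact act.one_smul x
  have h1 : ∀ x : ellipsoid a, act.smul (Circle.exp (2 * Real.pi)) x = x := fun x => by
    rw [Circle.exp_two_pi]
    exact act.one_smul x
  constructor
  · let x : ellipsoid a := ⟨!₂[a, 0, 0, 0], by simp [ellipsoid]⟩
    exact exists_int_of_rotating ha.ne' (fun t => hcoord x t 0) (fun t => hcoord x t 1)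
      (by rw [h0]; rfl) (by rw [h1]; rfl) (by rw [h1]; rfl)
  · let x : ellipsoid a := ⟨!₂[0, 0, 1, 0], by simp [ellipsoid]⟩
    exact exists_int_of_rotating one_ne_zero (fun t => hcoord x t 2) (fun t => hcoord x t 3)
      (by rw [h0]; rfl) (by rw [h1]; rfl) (by rw [h1]; rfl)

/-! ### Proportional Killing fields -/

/-- A quadratic function that vanishes near a point is zero. -/
theorem eq_zero_of_eventually_eq_zero {V : Type*} [NormedAddCommGroup V] [NormedSpace ℝ V]
    {Q : V → ℝ} (hpar : ∀ u v, Q (u + v) + Q (u - v) = 2 * Q u + 2 * Q v)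
    (hsmul : ∀ (t : ℝ) v, Q (t • v) = t ^ 2 * Q v) {u : V} (hu : ∀ᶠ v in nhds u, Q v = 0)
    (v : V) : Q v = 0 := by
  have hp : Filter.Tendsto (fun t : ℝ => u + t • v) (nhds 0) (nhds u) := by
    have : Continuous fun t : ℝ => u + t • v := by fun_prop
    simpa using this.tendsto 0
  have hm : Filter.Tendsto (fun t : ℝ => u - t • v) (nhds 0) (nhds u) := by
    have : Continuous fun t : ℝ => u - t • v := by fun_prop
    simpa using this.tendsto 0
  have hall := (hp.eventually hu).and (hm.eventually hu)
  obtain ⟨t, ⟨h1, h2⟩, ht⟩ :=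
    ((hall.filter_mono nhdsWithin_le_nhds).and
      (self_mem_nhdsWithin : ∀ᶠ t in nhdsWithin (0 : ℝ) {0}ᶜ, t ∈ ({0}ᶜ : Set ℝ))).exists
  have h := hpar u (t • v)
  rw [h1, h2, hu.self_of_nhds, hsmul] at h
  have : t ^ 2 * Q v = 0 := by linarith
  exact (mul_eq_zero.1 this).resolve_left (pow_ne_zero 2 ht)

/-- A linear field proportional to `p ∂_ξ + q ∂_μ` on an open set of the ellipsoid is so
everywhere: the minors vanish. -/
theorem minor_eq_zero {a p q : ℝ} (ha : 0 < a) {L : Matrix (Fin 4) (Fin 4) ℝ}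
    {F : EuclideanSpace ℝ (Fin 4) → ℝ} (hF : Continuous F) {f' : ellipsoid a → ℝ}
    (h : ∀ (x : ellipsoid a) (i : Fin 4), F x * rotation p q x i =
      f' x * ∑ j, L i j * (x : EuclideanSpace ℝ (Fin 4)) j)
    {x : ellipsoid a} (hx : F x ≠ 0) (i k : Fin 4) (v : EuclideanSpace ℝ (Fin 4)) :
    rotation p q v i * ∑ j, L k j * v j - rotation p q v k * ∑ j, L i j * v j = 0 := by
  -- The gauge of the ellipsoid: rescaling by `1 / N` turns the relation on the surface into one on
  -- a neighbourhood in `ℝ⁴`.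
  set N : EuclideanSpace ℝ (Fin 4) → ℝ := fun u =>
    √((u 0 ^ 2 + u 1 ^ 2) / a ^ 2 + u 2 ^ 2 + u 3 ^ 2) with hN
  have hNc : Continuous N := by fun_prop
  have hNx : N x = 1 := by
    have hx' : (x : EuclideanSpace ℝ (Fin 4)) 0 ^ 2 + (x : EuclideanSpace ℝ (Fin 4)) 1 ^ 2 =
      a ^ 2 * (1 - (x : EuclideanSpace ℝ (Fin 4)) 2 ^ 2 -
        (x : EuclideanSpace ℝ (Fin 4)) 3 ^ 2) := x.2
    simp only [hN]
    rw [hx', Real.sqrt_eq_one]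
    field_simp
    ring
  have hmem : ∀ u, N u ≠ 0 → (N u)⁻¹ • u ∈ ellipsoid a := by
    intro u hu
    have hsq : N u ^ 2 = (u 0 ^ 2 + u 1 ^ 2) / a ^ 2 + u 2 ^ 2 + u 3 ^ 2 :=
      Real.sq_sqrt (by positivity)
    change ((N u)⁻¹ * u 0) ^ 2 + ((N u)⁻¹ * u 1) ^ 2 =
      a ^ 2 * (1 - ((N u)⁻¹ * u 2) ^ 2 - ((N u)⁻¹ * u 3) ^ 2)
    field_simp at hsq ⊢
    linear_combination -hsq
  have hrs : ∀ (t : ℝ) (u : EuclideanSpace ℝ (Fin 4)) (l : Fin 4),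
      rotation p q (t • u) l = t * rotation p q u l := fun t u l =>
    congrArg (fun w : EuclideanSpace ℝ (Fin 4) => w l) ((rotationL p q).map_smul t u)
  have hra : ∀ (u w : EuclideanSpace ℝ (Fin 4)) (l : Fin 4),
      rotation p q (u + w) l = rotation p q u l + rotation p q w l := fun u w l =>
    congrArg (fun w : EuclideanSpace ℝ (Fin 4) => w l) ((rotationL p q).map_add u w)
  have hrm : ∀ (u w : EuclideanSpace ℝ (Fin 4)) (l : Fin 4),
      rotation p q (u - w) l = rotation p q u l - rotation p q w l := fun u w l =>
    congrArg (fun w : EuclideanSpace ℝ (Fin 4) => w l) ((rotationL p q).map_sub u w)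
  have hLs : ∀ (t : ℝ) (u : EuclideanSpace ℝ (Fin 4)) (l : Fin 4),
      ∑ j, L l j * (t • u) j = t * ∑ j, L l j * u j := fun t u l => by
    rw [Finset.mul_sum]
    exact Finset.sum_congr rfl fun j _ => by simp; ring
  refine eq_zero_of_eventually_eq_zero (u := (x : EuclideanSpace ℝ (Fin 4)))
    (Q := fun v : EuclideanSpace ℝ (Fin 4) => rotation p q v i * ∑ j, L k j * v j -
      rotation p q v k * ∑ j, L i j * v j) ?_ ?_ ?_ v
  · intro u w
    simp only [hra, hrm, PiLp.add_apply, PiLp.sub_apply, mul_add, mul_sub,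
      Finset.sum_add_distrib, Finset.sum_sub_distrib]
    ring
  · intro t u
    simp only [hrs, hLs]
    ring
  · have hN0 : ∀ᶠ u in nhds (x : EuclideanSpace ℝ (Fin 4)), N u ≠ 0 :=
      hNc.continuousAt.eventually_ne (by rw [hNx]; exact one_ne_zero)
    have hFc : ContinuousAt (fun u => F ((N u)⁻¹ • u)) (x : EuclideanSpace ℝ (Fin 4)) :=
      hF.continuousAt.comp
        ((hNc.continuousAt.inv₀ (by rw [hNx]; exact one_ne_zero)).smul continuousAt_id)
    have hF0 : ∀ᶠ u in nhds (x : EuclideanSpace ℝ (Fin 4)), F ((N u)⁻¹ • u) ≠ 0 :=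
      hFc.eventually_ne (by rw [hNx, inv_one, one_smul]; exact hx)
    filter_upwards [hN0, hF0] with u hu hFu
    have h1 := h ⟨_, hmem u hu⟩ i
    have h2 := h ⟨_, hmem u hu⟩ k
    simp only [hrs, hLs] at h1 h2
    -- Cross-multiplication eliminates `f'`, so no regularity of it is needed.
    have h3 : F ((N u)⁻¹ • u) * ((N u)⁻¹ ^ 2 * (rotation p q u i * ∑ j, L k j * u j -
        rotation p q u k * ∑ j, L i j * u j)) = 0 := by
      linear_combination ((N u)⁻¹ * ∑ j, L k j * u j) * h1 -
        ((N u)⁻¹ * ∑ j, L i j * u j) * h2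
    exact (mul_eq_zero.1 ((mul_eq_zero.1 h3).resolve_left hFu)).resolve_left
      (pow_ne_zero 2 (inv_ne_zero hu))

/-- A skew field proportional to `p ∂_ξ + q ∂_μ` with `p ≠ 0` is a rotation field. -/
theorem exists_rotation_of_minor_eq_zero {p q : ℝ} (hp : p ≠ 0)
    {L : Matrix (Fin 4) (Fin 4) ℝ} (hL : ∀ i j, L i j = -L j i)
    (h : ∀ (i k : Fin 4) (v : EuclideanSpace ℝ (Fin 4)),
      rotation p q v i * ∑ j, L k j * v j - rotation p q v k * ∑ j, L i j * v j = 0) :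
    ∃ p' q' : ℝ, p * q' = q * p' ∧ ∀ (u : EuclideanSpace ℝ (Fin 4)) (i : Fin 4),
      ∑ j, L i j * u j = rotation p' q' u i := by
  have hd : ∀ i, L i i = 0 := fun i => by linarith [hL i i]
  simp only [rotation_eq, Fin.sum_univ_four] at h ⊢
  -- On the first two basis vectors the rotation field stays in the `(x, y)`-plane, so the minors
  -- give `p` times the mixed entries of `L`. The vector `(1, 0, 1, 0)` then compares the two
  -- frequencies.
  have h20 : L 2 0 = 0 := by
    simpa [hp] using h 1 2 !₂[1, 0, 0, 0]
  have h30 : L 3 0 = 0 := by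
    simpa [hp] using h 1 3 !₂[1, 0, 0, 0]
  have h21 : L 2 1 = 0 := by
    simpa [hp] using h 0 2 !₂[0, 1, 0, 0]
  have h31 : L 3 1 = 0 := by
    simpa [hp] using h 0 3 !₂[0, 1, 0, 0]
  have hr := h 1 3 !₂[1, 0, 1, 0]
  simp [h30, hL 1 2, h21] at hr
  refine ⟨L 1 0, L 3 2, by linarith, fun u i => ?_⟩
  fin_cases i
  · simp [hd, hL 0 1, hL 0 2, hL 0 3, h20, h30]
  · simp [hd, hL 1 2, hL 1 3, h21, h31]
  · simp [hd, h20, h21, hL 2 3]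
  · simp [hd, h30, h31]

/-! ### `S¹`-zonal flows -/

/-- The circle-induced `X` need not be the given rotation field, and for `a = 1` Killing fields need
not be rotations in these planes. Proportionality near a point with `Z ≠ 0` nevertheless makes `X` a
rotation field of the same ratio, and its weights are integers. -/
theorem IsCircleZonal.ratioRationalOrInfinite {a p q : ℝ} (ha : 0 < a)
    {Z : VectorField (ellipsoid a)} {f : ellipsoid a → ℝ} (h0 : ∃ x, Z.val x ≠ 0)
    (hf : IsSmooth (ellipsoid a) f)
    (hZ : ∀ x : ellipsoid a, (Z.val x : EuclideanSpace ℝ (Fin 4)) = f x • rotation p q x)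
    (hc : IsCircleZonal Z) : RatioRationalOrInfinite p q := by
  by_cases hp : p = 0
  · exact Or.inl hp
  obtain ⟨F, hF, hFf⟩ := hf
  obtain ⟨-, f', X, -, hX, hZX, hXc⟩ := hc
  obtain ⟨L, hLs, hL⟩ := hX.exists_skew ha
  obtain ⟨x, hx⟩ := h0
  have hx' : (Z.val x : EuclideanSpace ℝ (Fin 4)) ≠ 0 := fun h => hx (Subtype.ext h)
  have hFx : F x ≠ 0 := fun h => hx' (by rw [hZ, ← hFf, h, zero_smul])
  have hprop : ∀ (x : ellipsoid a) (i : Fin 4), F x * rotation p q x i =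
      f' x * ∑ j, L i j * (x : EuclideanSpace ℝ (Fin 4)) j := by
    intro y i
    have h1 := hZ y
    rw [hZX] at h1
    have h2 := congrArg (fun w : EuclideanSpace ℝ (Fin 4) => w i) h1
    rw [← hL, hFf]
    exact h2.symm
  obtain ⟨p', q', hpq, hrot⟩ := exists_rotation_of_minor_eq_zero hp hLs
    fun i k v => minor_eq_zero ha hF.continuous hprop hFx i k v
  have hXrot : ∀ y : ellipsoid a, (X.val y : EuclideanSpace ℝ (Fin 4)) = rotation p' q' y := by
    intro y
    ext i
    rw [hL, hrot]
  obtain ⟨⟨n, hn⟩, ⟨m, hm⟩⟩ := hXc.exists_int ha hXrot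
  have hp' : p' ≠ 0 := by
    intro h
    have hq' : q' = 0 := by simpa [h, hp] using hpq
    apply hx
    rw [hZX]
    have : X.val x = 0 := Subtype.ext (by rw [hXrot, h, hq']; simp [rotation])
    rw [this, smul_zero]
  refine Or.inr ⟨m / n, ?_⟩
  push_cast
  rw [← hn, ← hm, div_eq_div_iff hp hp']
  linarith

/-- A rational ratio allows `p = c n` and `q = c m` with integers `n`, `m`. The constant `c` moves
into the factor, and the circle action of weights `n`, `m` induces the remaining field. -/
theorem isCircleZonal_of_ratioRationalOrInfinite {a p q : ℝ} (ha : 0 < a)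
    {Z : VectorField (ellipsoid a)} {f : ellipsoid a → ℝ} (hzonal : IsZonal Z)
    (hf : IsSmooth (ellipsoid a) f)
    (hZ : ∀ x : ellipsoid a, (Z.val x : EuclideanSpace ℝ (Fin 4)) = f x • rotation p q x)
    (h : RatioRationalOrInfinite p q) : IsCircleZonal Z := by
  obtain ⟨c, n, m, hcn, hcm⟩ : ∃ (c : ℝ) (n m : ℤ), p = c * n ∧ q = c * m := by
    rcases h with h | ⟨r, hr⟩
    · exact ⟨q, 0, 1, by simp [h], by simp⟩
    -- Division by zero gives `0` in Lean, so `p = 0` can also occur in the rational alternative.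
    · by_cases hp : p = 0
      · exact ⟨q, 0, 1, by simp [hp], by simp⟩
      · have hd : (r.den : ℝ) ≠ 0 := mod_cast r.den_ne_zero
        refine ⟨p / r.den, r.den, r.num, by simp [hd], ?_⟩
        rw [div_eq_iff hp, Rat.cast_def] at hr
        rw [hr]
        ring
  obtain ⟨F, hF, hFf⟩ := hf
  refine ⟨hzonal, fun x => f x * c, rotationField a ha n m,
    ⟨fun u => F u * c, hF.mul contDiff_const, fun x => congrArg (· * c) (hFf x)⟩,
    isKilling_rotationField a ha n m, fun x => Subtype.ext ?_,
    isInducedByCircleAction_rotationField a ha n m⟩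
  rw [hZ, Submodule.coe_smul]
  change _ = (f x * c) • rotation n m x
  rw [mul_smul, hcn, hcm]
  simp only [rotation, smul_add, smul_smul]

end

end ZonalFlow

/-! ### The classification of non-geodesic and `S¹`-zonal flows -/

theorem mainTheorem4 (a : ℝ) (ha : 0 < a) :
    -- non-geodesic zonal flows
    (a ≠ 1 → ∀ Z : ZonalFlow.VectorField (ZonalFlow.ellipsoid a),
      ZonalFlow.IsNonGeodesicZonal Z →
      ∃ (p q : ℝ) (f : ℝ → ℝ), a ^ 2 * p ^ 2 ≠ q ^ 2 ∧
        ZonalFlow.IsSmooth (ZonalFlow.ellipsoid a) (fun x => f (ZonalFlow.chi x)) ∧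
        ∀ x : ZonalFlow.ellipsoid a, (Z.val x : EuclideanSpace ℝ (Fin 4)) =
          f (ZonalFlow.chi x) • (p • ZonalFlow.dXi x + q • ZonalFlow.dMu x)) ∧
    -- `S¹`-zonal flows
    (∀ (Z : ZonalFlow.VectorField (ZonalFlow.ellipsoid a)) (p q : ℝ)
        (f : ZonalFlow.ellipsoid a → ℝ),
      ZonalFlow.IsZonal Z → (∃ x, Z.val x ≠ 0) →
      ZonalFlow.IsSmooth (ZonalFlow.ellipsoid a) f →
      (∀ x : ZonalFlow.ellipsoid a, (Z.val x : EuclideanSpace ℝ (Fin 4)) =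
        f x • (p • ZonalFlow.dXi x + q • ZonalFlow.dMu x)) →
      (ZonalFlow.IsCircleZonal Z ↔ ZonalFlow.RatioRationalOrInfinite p q)) ∧
    -- non-geodesic `S¹`-zonal flows
    (a ≠ 1 → ∀ Z : ZonalFlow.VectorField (ZonalFlow.ellipsoid a), ZonalFlow.IsZonal Z →
      ((ZonalFlow.IsNonGeodesicZonal Z ∧ ZonalFlow.IsCircleZonal Z) ↔
        ∃ (p q : ℝ) (f : ℝ → ℝ), a ^ 2 * p ^ 2 ≠ q ^ 2 ∧
          ZonalFlow.RatioRationalOrInfinite p q ∧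
          ZonalFlow.IsSmooth (ZonalFlow.ellipsoid a) (fun x => f (ZonalFlow.chi x)) ∧
          (∃ x : ZonalFlow.ellipsoid a, f (ZonalFlow.chi x) ≠ 0) ∧
          ∀ x : ZonalFlow.ellipsoid a, (Z.val x : EuclideanSpace ℝ (Fin 4)) =
            f (ZonalFlow.chi x) • (p • ZonalFlow.dXi x + q • ZonalFlow.dMu x))) := by
  refine ⟨fun ha1 Z hZ => hZ.exists_factor ha ha1, fun Z p q f hzonal h0 hf hZ =>
    ⟨fun hc => hc.ratioRationalOrInfinite ha h0 hf hZ,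
      fun h => ZonalFlow.isCircleZonal_of_ratioRationalOrInfinite ha hzonal hf hZ h⟩,
    fun ha1 Z hzonal => ⟨fun ⟨hZ, hc⟩ => ?_, fun ⟨p, q, f, hpq, hr, hf, h0, hZf⟩ => ⟨⟨hzonal, ?_⟩,
      ZonalFlow.isCircleZonal_of_ratioRationalOrInfinite ha hzonal hf hZf hr⟩⟩⟩
  · obtain ⟨p, q, f, hpq, hf, hZf⟩ := hZ.exists_factor ha ha1
    -- The zero field is geodesic, so a non-geodesic flow is nonzero somewhere.
    have h0 : ∃ x, Z.val x ≠ 0 := by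
      by_contra! h
      exact hZ.2 ⟨hzonal, fun x => by rw [h, map_zero]⟩
    refine ⟨p, q, f, hpq, hc.ratioRationalOrInfinite ha h0 hf hZf, hf, ?_, hZf⟩
    obtain ⟨x, hx⟩ := h0
    refine ⟨x, fun h => hx (Subtype.ext ?_)⟩
    rw [hZf, h, zero_smul]
    rfl
  · intro hg
    obtain ⟨x, hx⟩ := ZonalFlow.exists_nabla_ne_zero hpq hf hZf h0
    exact hx (hg.2 x)
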